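/- A box is a pair (row, column), rows being numbered from top to bottom and columns from left to right. For a strict partition $\lambda=(\lambda_1>\dots>\lambda_k>0)$ the \emph{shifted shape} $\lambda$ has $\lambda_i$ boxes in row $i$, in the columns $i,\dots,i+\lambda_i-1$. An \emph{increasing shifted tableau} of shape $\lambda$ (resp. skew shape $\lambda/\mu$ with $\mu\subseteq\lambda$) is a filling of the boxes of $\lambda$ (resp. $\lambda\setminus\mu$) with positive integers, strictly increasing left to right along rows and top to bottom down columns. \emph{Shifted Hecke insertion.} To insert a positive integer $x$ into an increasing shifted tableau $T$, start by inserting $x$ into the first row. To insert $x$ into a row (resp. column): (1) if $x$ is weakly larger than all entries of the row (resp. column) and adjoining $x$ at its end gives an increasing shifted tableau, do so and stop (the end of an empty row is its position on the main diagonal, the end of an empty column its position in the first row); (2) if $x$ is weakly larger than all entries but adjoining $x$ does not give an increasing shifted tableau, stop without change. Otherwise let $y$ be the smallest entry of the row (resp. column) that is strictly larger than $x$: (3) if replacing $y$ by $x$ gives an increasing shifted tableau, replace it; (4) otherwise change nothing; in both cases continue by inserting $y$ into the next column to the right if $x$ was inserted into a column or if $y$ was on the main diagonal, and into the next row below otherwise.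 The insertion tableau $P(w)$ of a word $w=w_1\cdots w_n$ of positive integers is obtained by inserting $w_1,\dots,w_n$ successively, starting from the empty tableau. \emph{Shifted $K$-rectification.} For labels $r$ and $\circ$, the switch $(r,\circ)$ simultaneously relabels by $\circ$ each box labelled $r$ that shares an edge with a box labelled $\circ$, and by $r$ each box labelled $\circ$ that shares an edge with a box labelled $r$. Let $T$ be an increasing shifted tableau of skew shape $\lambda/\mu$ with largest entry $q$. Number the boxes of $\mu$ by $1,\dots,p=|\mu|$, row by row from top to bottom and left to right in each row. The \emph{superstandard $K$-rectification} of $T$ is obtained by performing the following slide for $k=p,p-1,\dots,1$: label box number $k$ of $\mu$ by $\circ$, perform the switches $(1,\circ),(2,\circ),\dots,(q,\circ)$ in this order, and delete the boxes labelled $\circ$. \emph{The antidiagonal tableau.} For a word $w=w_1\cdots w_n$ of positive integers, $T_w$ is the increasing shifted tableau of skew shape $(2n-1,2n-3,\dots,1)/(2n-2,2n-4,\dots,2)$ whose entry in row $n+1-i$ and column $n-1+i$ is $w_i$, for $1\le i\le n$; so $w_1$ is in the bottom box, on the main diagonal. \textbf{Theorem.} For every word $w$ of positive integers, the superstandard $K$-rectification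 of $T_w$ equals the insertion tableau $P(w)$. -/

import Mathlib

namespace ShiftedHecke

/-! ### Shifted shapes and increasing shifted tableaux

A box is a pair `(row, column)`, counted from `0`, rows from top to bottom and columns from left to
right.  The main diagonal consists of the boxes `(i, i)`. -/

/-- A box `(row, column)`. -/
abbrev Box : Type := ℕ × ℕ

/-- A filling of some boxes by labels in `α`; the value `none` means that the box is absent. -/
abbrev Filling (α : Type) : Type := Box → Option α

/-- The filling `T` with box `b` (re)labelled by `x`; if `b` was absent, it is added. -/
def Filling.set {α : Type} (T : Filling α) (b : Box) (x : α) : Filling α :=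
  Function.update T b (some x)

/-- The list `l` is a strict partition `l₁ > l₂ > ⋯ > l_k > 0`. -/
def IsStrictPartition (l : List ℕ) : Prop :=
  l.Pairwise (fun a b => b < a) ∧ ∀ a ∈ l, 0 < a

/-- The shifted shape of `l`: row `i` consists of `lᵢ` boxes, the first of them on the diagonal. -/
def shiftedShape (l : List ℕ) : Set Box :=
  {b | b.1 ≤ b.2 ∧ b.2 < b.1 + l.getD b.1 0}

/-- The labels strictly increase from left to right along rows and from top to bottom down
columns. -/
def IsIncreasing (T : Filling ℕ) : Prop :=
  (∀ i j j' x y, j < j' → T (i, j) = some x → T (i, j') = some y → x < y) ∧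
  (∀ i i' j x y, i < i' → T (i, j) = some x → T (i', j) = some y → x < y)

/-- An increasing shifted skew tableau of shape `outer / inner`, filled by positive integers. -/
structure SkewTableau where
  outer : List ℕ
  inner : List ℕ
  outer_strict : IsStrictPartition outer
  inner_strict : IsStrictPartition inner
  inner_subset : shiftedShape inner ⊆ shiftedShape outer
  entry : Filling ℕ
  isSome_iff : ∀ b, (entry b).isSome ↔ b ∈ shiftedShape outer \ shiftedShape inner
  pos : ∀ b x, entry b = some x → 0 < x
  increasing : IsIncreasing entry

/-- `T` is an increasing shifted tableau (of some shifted straight shape). -/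
def IsIncreasingTableau (T : Filling ℕ) : Prop :=
  ∃ l : List ℕ, IsStrictPartition l ∧ (∀ b, (T b).isSome ↔ b ∈ shiftedShape l) ∧
    (∀ b x, T b = some x → 0 < x) ∧ IsIncreasing T

/-! ### Shifted Hecke insertion -/

/-- A row or a column, into which a letter is inserted. -/
inductive Line : Type
  | row (i : ℕ)
  | col (j : ℕ)

/-- The box `b` lies on the line. -/
def Line.Contains : Line → Box → Prop
  | .row i, b => b.1 = i
  | .col j, b => b.2 = j

/-- `b` is the position at which a new box is adjoined to the end of the line: the first absent
position of the row, starting from the main diagonal, respectively the first absent position of the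
column, starting from the top row. -/
def Line.IsEnd (T : Filling ℕ) : Line → Box → Prop
  | .row i, b => b.1 = i ∧ i ≤ b.2 ∧ T b = none ∧ ∀ j, i ≤ j → j < b.2 → T (i, j) ≠ none
  | .col j, b => b.2 = j ∧ T b = none ∧ ∀ i, i < b.1 → T (i, j) ≠ none

/-- The line into which the output integer is inserted, when the output integer was found in the
box `b` of the given line: the next column to the right after a column insertion or if `b` is on the
main diagonal, the row below otherwise. -/
def Line.next : Line → Box → Line
  | .row i, b => if b.1 = b.2 then .col (b.2 + 1) else .row (i + 1)
  | .col j, _ => .col (j + 1)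

/-- `x` is weakly larger than all integers in the line. -/
def Line.AllLE (T : Filling ℕ) (L : Line) (x : ℕ) : Prop :=
  ∀ b y, L.Contains b → T b = some y → y ≤ x

/-- The box `b` of the line has label `y`, and `y` is the smallest label of the line that is
strictly larger than `x`. -/
def Line.IsBumped (T : Filling ℕ) (L : Line) (x : ℕ) (b : Box) (y : ℕ) : Prop :=
  L.Contains b ∧ T b = some y ∧ x < y ∧
    ∀ c z, L.Contains c → T c = some z → x < z → y ≤ z

/-- `InsertsTo L T x T'`: inserting `x` into the line `L` of `T`, and carrying on with the output
integers until the insertion terminates, results in `T'`. The constructors are the four rules of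
shifted Hecke insertion. -/
inductive InsertsTo : Line → Filling ℕ → ℕ → Filling ℕ → Prop
  | adjoin {L : Line} {T : Filling ℕ} {x : ℕ} {b : Box}
      (hx : L.AllLE T x) (hb : L.IsEnd T b) (h : IsIncreasingTableau (T.set b x)) :
      InsertsTo L T x (T.set b x)
  | stay {L : Line} {T : Filling ℕ} {x : ℕ} {b : Box}
      (hx : L.AllLE T x) (hb : L.IsEnd T b) (h : ¬ IsIncreasingTableau (T.set b x)) :
      InsertsTo L T x T
  | replace {L : Line} {T T' : Filling ℕ} {x y : ℕ} {b : Box}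
      (hb : L.IsBumped T x b y) (h : IsIncreasingTableau (T.set b x))
      (rest : InsertsTo (L.next b) (T.set b x) y T') :
      InsertsTo L T x T'
  | bump {L : Line} {T T' : Filling ℕ} {x y : ℕ} {b : Box}
      (hb : L.IsBumped T x b y) (h : ¬ IsIncreasingTableau (T.set b x))
      (rest : InsertsTo (L.next b) T y T') :
      InsertsTo L T x T'

/-- `IsInsertionTableau w P`: shifted Hecke insertion of the letters of `w` from left to right,
each starting in the first row, and beginning with the empty tableau, results in `P`. -/
inductive IsInsertionTableau : List ℕ → Filling ℕ → Prop
  | nil : IsInsertionTableau [] (fun _ => none)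
  | snoc {w : List ℕ} {x : ℕ} {T T' : Filling ℕ}
      (hT : IsInsertionTableau w T) (hx : InsertsTo (.row 0) T x T') :
      IsInsertionTableau (w ++ [x]) T'

/-! ### Shifted K-theoretic jeu de taquin -/

/-- Two boxes are adjacent if they share a common edge. -/
def Adjacent (a b : Box) : Prop :=
  (a.1 = b.1 ∧ (a.2 + 1 = b.2 ∨ b.2 + 1 = a.2)) ∨
  (a.2 = b.2 ∧ (a.1 + 1 = b.1 ∨ b.1 + 1 = a.1))

open Classical in
/-- The K-theoretic switch operator `(i, j)`. -/
noncomputable def switch {α : Type} (i j : α) (T : Filling α) : Filling α := fun a =>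
  if T a = some i ∧ ∃ b, Adjacent a b ∧ T b = some j then some j
  else if T a = some j ∧ ∃ b, Adjacent a b ∧ T b = some i then some i
  else T a

/-- Labels during a slide: the symbol `∘` or a number. -/
inductive Label : Type
  | circ
  | num (n : ℕ)

open Classical in
/-- The filling `T` with the boxes of `C` labelled by `∘`. -/
noncomputable def addCirc (C : Set Box) (T : Filling ℕ) : Filling Label := fun b =>
  if b ∈ C then some .circ else (T b).map .num

/-- Delete the boxes that are labelled by `∘`. -/
def eraseCirc (T : Filling Label) : Filling ℕ := fun b =>
  match T b with
  | some (.num n) => some n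
  | _ => none

/-- The forward slide of `T`, with values in the interval `[lo, hi]`, starting from `C`: the
switches `(lo, ∘), (lo + 1, ∘), …, (hi, ∘)` are performed in this order. -/
noncomputable def kjdt (lo hi : ℕ) (C : Set Box) (T : Filling ℕ) : Filling ℕ :=
  eraseCirc ((List.range' lo (hi + 1 - lo)).foldl (fun S r => switch (.num r) .circ S)
    (addCirc C T))

/-- The superstandard tableau of shifted shape `l`: the rows are filled from top to bottom, each
from left to right, by `1, 2, …, |l|`. -/
def superstandard (l : List ℕ) : Filling ℕ := fun b =>
  if b.1 ≤ b.2 ∧ b.2 < b.1 + l.getD b.1 0 then some ((l.take b.1).sum + (b.2 - b.1) + 1) else none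

/-- The largest entry of `T` (`0` if there are no entries). -/
noncomputable def SkewTableau.maxEntry (T : SkewTableau) : ℕ :=
  sSup {x | ∃ b, T.entry b = some x}

/-- The superstandard K-rectification of a shifted skew tableau of shape `λ/μ`. The box of `μ` with
label `k` in the superstandard tableau of shape `μ` is the starting box of a forward slide; these
slides are performed for `k = |μ|, |μ| - 1, …, 1`, in this order. -/
noncomputable def SkewTableau.superstandardRectification (T : SkewTableau) : Filling ℕ :=
  (List.range' 1 T.inner.sum).reverse.foldl
    (fun S k => kjdt 1 T.maxEntry {b | superstandard T.inner b = some k} S) T.entry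

/-! ### The antidiagonal tableau of a word -/

/-- The filling of the antidiagonal by `w = w₁ ⋯ wₙ`: the box in row `i` (counted from `0`) and
column `2 (n - 1) - i` is labelled by `w_{n-i}`, so that the bottom box, labelled by `w₁`, is on the
main diagonal, and the labels from bottom to top are `w₁, …, wₙ`. -/
def antidiagonalFilling (w : List ℕ) : Filling ℕ := fun b =>
  if b.1 + b.2 + 2 = 2 * w.length then w.reverse[b.1]? else none

/-- The outer shape `(2n - 1, 2n - 3, …, 1)`. -/
def antidiagonalOuter (n : ℕ) : List ℕ := (List.range n).map fun i => 2 * (n - i) - 1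

/-- The inner shape `(2n - 2, 2n - 4, …, 2)`. -/
def antidiagonalInner (n : ℕ) : List ℕ := (List.range (n - 1)).map fun i => 2 * (n - i) - 2

theorem antidiagonalOuter_getD (n i : ℕ) :
    (antidiagonalOuter n).getD i 0 = 2 * (n - i) - 1 := by
  unfold antidiagonalOuter
  by_cases h : i < n
  · simp [List.getD, h]
  · simp [List.getD, h]; omega

theorem antidiagonalInner_getD (n i : ℕ) :
    (antidiagonalInner n).getD i 0 = 2 * (n - i) - 2 := by
  unfold antidiagonalInner
  by_cases h : i < n - 1
  · simp [List.getD, h]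
  · simp [List.getD, h]; omega

theorem antidiagonalFilling_row {w : List ℕ} {b : Box} {x : ℕ}
    (h : antidiagonalFilling w b = some x) : b.1 + b.2 + 2 = 2 * w.length ∧ b.1 < w.length := by
  unfold antidiagonalFilling at h
  split_ifs at h with h1
  obtain ⟨h2, -⟩ := List.getElem?_eq_some_iff.1 h
  exact ⟨h1, by simpa using h2⟩

theorem isSome_getElem?_iff (l : List ℕ) (i : ℕ) : (l[i]?).isSome ↔ i < l.length := by
  simp

/-- The antidiagonal tableau `T_w` of a word `w` of positive integers. -/
def antidiagonalTableau (w : List ℕ) (hw : ∀ x ∈ w, 0 < x) : SkewTableau where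
  outer := antidiagonalOuter w.length
  inner := antidiagonalInner w.length
  outer_strict := by
    refine ⟨?_, ?_⟩
    · unfold antidiagonalOuter
      rw [List.pairwise_map]
      refine List.Pairwise.imp_of_mem ?_ (List.pairwise_lt_range (n := w.length))
      intro a b ha hb hab
      rw [List.mem_range] at ha hb
      omega
    · intro a ha
      unfold antidiagonalOuter at ha
      simp only [List.mem_map, List.mem_range] at ha
      obtain ⟨i, hi, rfl⟩ := ha
      omega
  inner_strict := by
    refine ⟨?_, ?_⟩
    · unfold antidiagonalInner
      rw [List.pairwise_map]
      refine List.Pairwise.imp_of_mem ?_ (List.pairwise_lt_range (n := w.length - 1))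
      intro a b ha hb hab
      rw [List.mem_range] at ha hb
      omega
    · intro a ha
      unfold antidiagonalInner at ha
      simp only [List.mem_map, List.mem_range] at ha
      obtain ⟨i, hi, rfl⟩ := ha
      omega
  inner_subset := by
    rintro b ⟨h1, h2⟩
    rw [antidiagonalInner_getD] at h2
    refine ⟨h1, ?_⟩
    rw [antidiagonalOuter_getD]
    omega
  entry := antidiagonalFilling w
  isSome_iff := by
    intro b
    simp only [shiftedShape, Set.mem_sdiff, Set.mem_ofPred_eq, antidiagonalInner_getD,
      antidiagonalOuter_getD, antidiagonalFilling]
    split_ifs with h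
    · rw [isSome_getElem?_iff, List.length_reverse]
      omega
    · simp only [Option.isSome_none]
      constructor
      · intro h'
        cases h'
      · intro h'
        omega
  pos := by
    intro b x h
    unfold antidiagonalFilling at h
    split_ifs at h
    exact hw x (List.mem_reverse.1 (List.mem_of_getElem? h))
  increasing := by
    constructor
    · intro i j j' x y hj hx hy
      have h1 := (antidiagonalFilling_row hx).1
      have h2 := (antidiagonalFilling_row hy).1
      simp only at h1 h2
      omega
    · intro i i' j x y hi hx hy
      have h1 := (antidiagonalFilling_row hx).1
      have h2 := (antidiagonalFilling_row hy).1
      simp only at h1 h2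
      omega

end ShiftedHecke

namespace ShiftedHecke

/-! ### Growth diagrams, row by row -/

/-! The proof is by induction on the word, appending a letter x to a word w of length n. For n > 0
the antidiagonal tableau of wx is that of w moved by (1, 1), with x added in the first row, column N
= 2n, and the superstandard order slides into all boxes of the lower rows before those of the first
row. During that first phase the box of x has no neighbour, so by induction the phase leaves P(w),
moved by (1, 1), together with x (`foldl_kjdt_embed`). What remains is `foldl_kjdt_eq_insertion`:
sliding into the boxes N, ..., 1 of the first row inserts x.

Those N slides are encoded in one growth diagram `U t i j` with values in 0, ..., N + 1. Its level
m, see `IsLevel`, is the filling present when the slides N, ..., m + 1 are done: level N is the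
start, level 0 the result. In the other direction, `U t` records where the holes 1, ..., N stand
after the labels 1, ..., t have passed them; `U 0` is the first row 1, ..., N. Any family that
starts there and obeys the local rule `SlideStep` computes the slides (`IsLevel.foldl_kjdt`), so it
suffices to exhibit one whose level 0 is the insertion tableau.

The explicit family is a ribbon along the boundary of the boxes with labels at most t in P(w), each
row given by four numbers (`RowData`). Inside a row, column j holds j + 1 before x is reached; once
x is being inserted, it holds j in the rows up to the one receiving the current letter and j + 1
below, and j everywhere during column insertion.

Insertion is followed by the size of labels rather than by bumps. The bumped letters increase, so at
time r there is one line L and one letter y ≤ r waiting there (`InsState`). If r + 1 does not occur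
on L, nothing changes; otherwise r + 1 is bumped to the next line, and y takes its box if that is
allowed. In both cases the boxes with labels at most r + 1, before the waiting letter is placed, are
the same as in P(w). Each transition obeys `SlideStep` by linear arithmetic on two or three
consecutive rows (the lemmas `slideStep_...`). Finally `U t` vanishes, on and above the diagonal,
exactly at the labels at most t of the result, so level 0 is the insertion tableau. -/

/-- Row ends of the shape obtained from the shape with row ends `a` by moving it one row down and
one column to the right, and placing a row with end `N` on top. -/
def skewEnd (N : ℕ) (a : ℕ → ℕ) : ℕ → ℕ
  | 0 => N
  | i + 1 => a i + 1

theorem skewEnd_zero (N : ℕ) (a : ℕ → ℕ) : skewEnd N a 0 = N := rfl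

theorem skewEnd_succ (N : ℕ) (a : ℕ → ℕ) (i : ℕ) : skewEnd N a (i + 1) = a i + 1 := rfl

/-- A row of a growth diagram: it is `0` before column `K`, maximal from column `S` on, and in
between it is `o` in column `K` and `j + c` in the columns `j` after `K`. -/
structure RowData where
  K : ℕ
  S : ℕ
  o : ℕ
  c : ℕ

/-- The order of the tests matters: if K = S, the row jumps from 0 to N + 1 and `o` is not used. -/
def RowData.val (N : ℕ) (R : RowData) (j : ℕ) : ℕ :=
  if j < R.K then 0 else if R.S ≤ j then N + 1 else if j = R.K then R.o else j + R.c

theorem RowData.val_cases (N : ℕ) (R : RowData) (j : ℕ) :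
    (j < R.K ∧ R.val N j = 0) ∨ (R.K ≤ j ∧ R.S ≤ j ∧ R.val N j = N + 1) ∨
    (j = R.K ∧ j < R.S ∧ R.val N j = R.o) ∨ (R.K < j ∧ j < R.S ∧ R.val N j = j + R.c) := by
  unfold RowData.val
  split_ifs <;> omega

/-- The default 0 outside the quarter plane is neutral for the maximum in `SlideStep`. -/
def leftOf (U : ℕ → ℕ → ℕ) (i : ℕ) : ℕ → ℕ
  | 0 => 0
  | j + 1 => U i j

def upOf (U : ℕ → ℕ → ℕ) (i j : ℕ) : ℕ :=
  match i with
  | 0 => 0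
  | i + 1 => U i j

/-- One step of a growth diagram, with values between `0` and `M`. -/
structure SlideStep (M : ℕ) (U V : ℕ → ℕ → ℕ) : Prop where
  le (i j : ℕ) : V i j ≤ U i j
  eq_max (i j : ℕ) (h : V i j < U i j) : V i j = max (leftOf U i j) (upOf U i j)
  lt_iff (i j : ℕ) (h0 : 0 < U i j) (hM : U i j < M) :
    V i j < U i j ↔ V i (j + 1) = U i j ∨ V (i + 1) j = U i j

/-- The conditions under which a row `R` of a growth diagram may turn into the row `R'`, where `X`
is the old row above and `Y` is the new row below. -/
structure RowStep (N : ℕ) (X R R' Y : RowData) : Prop where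
  K_le : R.K ≤ R'.K
  K_le_succ : R'.K ≤ R.K + 1
  K_le_S : R'.K ≤ R.S
  S_le : R.S ≤ R'.S
  S_le_succ : R'.S ≤ R.S + 1
  c_le : R'.c ≤ R.c
  c_le_one : R.c ≤ 1
  above : R.S ≤ X.K + 1
  below : R'.K ≤ Y.S ∧ Y.S ≤ R'.K + 1 ∧ Y.K ≤ Y.S
  grow : R'.K = R.K + 1 → R.K < X.K
  first : R'.K = R.K → R.K < R.S → R'.o = R.o ∨ (R'.o < R.o ∧
    ((R.K < X.K ∧ R'.o = 0) ∨ (R.K = X.K ∧ R.K < X.S ∧ R'.o = X.o)))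
  second : R'.K = R.K + 1 → R.K + 1 < R.S → R'.o = R.K + 1 + R.c ∨ (R'.o < R.K + 1 + R.c ∧
    ((R.K + 1 < X.K ∧ R'.o = R.o) ∨ (R.K + 1 = X.K ∧ X.K < X.S ∧ R'.o = max R.o X.o)))
  shift : R'.c < R.c → R'.K + 1 < R.S → R'.K = R.K + 1 ∧ R'.S = R.S + 1 ∧
    (X.K + 1 = R.S → X.K < X.S ∧ X.o ≤ X.K)
  last_le : R'.S = R.S + 1 → (R'.K = R.S → R'.o ≤ N + 1) ∧ (R'.K < R.S → R.S + R'.c ≤ N + 1)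
  last_lt : R'.S = R.S + 1 → R.S < X.K ∨ R.S < X.S
  last (l u v : ℕ) : R'.S = R.S + 1 →
    (R'.K = R.S ∧ v = R'.o) ∨ (R'.K < R.S ∧ v = R.S + R'.c) →
    (R.K = R.S ∧ l = 0) ∨ (R.K + 1 = R.S ∧ l = R.o) ∨ (R.K + 1 < R.S ∧ l + 1 = R.S + R.c) →
    (R.S < X.K ∧ u = 0) ∨ (R.S = X.K ∧ u = X.o) ∨ (R.S = X.K + 1 ∧ u = R.S + X.c) →
    v = max l u
  first_iff : R'.K = R.K → R.K < R.S → 0 < R.o → (R'.o < R.o ↔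
    (R.K + 1 < R'.S ∧ R.K + 1 + R'.c = R.o) ∨
    (Y.S = R.K + 1 ∧ ((R.K = Y.K ∧ Y.o = R.o) ∨ (Y.K < R.K ∧ R.K + Y.c = R.o))))
  grow_eq : R'.K = R.K + 1 → 0 < R.o → (R.K + 1 < R'.S ∧ R'.o = R.o) ∨
    (R.K = Y.K ∧ Y.o = R.o) ∨ (Y.K < R.K ∧ R.K + Y.c = R.o)
  second_iff : R'.K = R.K + 1 → R.K + 1 < R.S → (R'.o < R.K + 1 + R.c ↔
    (R.K + 2 < R'.S ∧ 1 + R'.c = R.c) ∨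
    (Y.S = R.K + 2 ∧ ((Y.K = R.K + 1 ∧ Y.o = R.K + 1 + R.c) ∨ (Y.K < R.K + 1 ∧ Y.c = R.c))))

section

variable {N : ℕ} {X R R' Y : RowData}

theorem RowStep.val_le (h : RowStep N X R R' Y) (j : ℕ) : R'.val N j ≤ R.val N j := by
  have h1 := R.val_cases N j
  have h2 := R'.val_cases N j
  have a1 := h.K_le
  have a2 := h.K_le_succ
  have a3 := h.K_le_S
  have a4 := h.S_le
  have a5 := h.S_le_succ
  have a6 := h.c_le
  rcases h1 with h1 | h1 | h1 | h1
  · lia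
  · by_cases hj : j = R.S ∧ R'.S = R.S + 1
    · have := h.last_le hj.2
      lia
    · lia
  · by_cases hK : R'.K = R.K
    · have := h.first hK (by lia)
      lia
    · lia
  · by_cases hj : j = R'.K
    · have := h.second (by lia) (by lia)
      lia
    · lia

/-- A value can drop in four places: the old first box, the new first box, the interior (when c
falls from 1 to 0), and the box gained in column `R.S`. The bound `j < R'.S` is what allows a
fictitious zero row above the top row. -/
theorem RowStep.val_eq_max (h : RowStep N X R R' Y) {j l : ℕ} (hlt : R'.val N j < R.val N j)
    (hl : (j = 0 ∧ l = 0) ∨ ∃ j', j = j' + 1 ∧ l = R.val N j') :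
    j < R'.S ∧ R'.val N j = max l (X.val N j) := by
  have hl' : (j ≤ R.K ∧ l = 0) ∨ (j = R.K + 1 ∧ R.K < R.S ∧ l = R.o) ∨
      (R.K + 1 < j ∧ j ≤ R.S ∧ l + 1 = j + R.c) ∨ R.S < j := by
    rcases hl with hl | ⟨j', rfl, rfl⟩
    · lia
    · have := R.val_cases N j'
      lia
  clear hl
  have h1 := R.val_cases N j
  have h2 := R'.val_cases N j
  have h3 := X.val_cases N j
  have a1 := h.K_le
  have a2 := h.K_le_succ
  have a3 := h.K_le_S
  have a4 := h.S_le
  have a5 := h.S_le_succ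
  have a6 := h.c_le
  have a7 := h.c_le_one
  have a8 := h.above
  rcases h1 with h1 | h1 | h1 | h1
  · lia
  · by_cases hj : j = R.S ∧ R'.S = R.S + 1
    · obtain rfl : j = R.S := hj.1
      have h5 := h.last_lt hj.2
      refine ⟨by lia, h.last l _ _ hj.2 ?_ ?_ ?_⟩
      · clear h3 hl'
        lia
      · clear h2 h3
        lia
      · clear h2 hl'
        lia
    · clear h3 hl'
      lia
  · by_cases hK : R'.K = R.K
    · have := h.first hK (by lia)
      rcases this with h4 | ⟨-, h4 | h4⟩ <;> lia
    · have := h.grow (by lia)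
      lia
  · by_cases hj : j = R'.K
    · have := h.second (by lia) (by lia)
      rcases this with h4 | ⟨-, h4 | h4⟩ <;> lia
    · have := h.shift (by lia) (by lia)
      lia

theorem RowStep.val_lt_iff (h : RowStep N X R R' Y) {j : ℕ} (h0 : 0 < R.val N j)
    (hN : R.val N j < N + 1) : R'.val N j < R.val N j ↔
      R'.val N (j + 1) = R.val N j ∨ Y.val N j = R.val N j := by
  have h1 := R.val_cases N j
  have h2 := R'.val_cases N j
  have h3 := R'.val_cases N (j + 1)
  have h4 := Y.val_cases N j
  have a1 := h.K_le
  have a2 := h.K_le_succ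
  have a3 := h.K_le_S
  have a4 := h.S_le
  have a5 := h.S_le_succ
  have a6 := h.c_le
  have a7 := h.below
  rcases h1 with h1 | h1 | h1 | h1
  · lia
  · lia
  · by_cases hK : R'.K = R.K
    · rw [show R'.val N j = R'.o by lia]
      have := h.first_iff hK (by lia) (by lia)
      clear h2
      rcases h3 with h3 | h3 | h3 | h3 <;> rcases h4 with h4 | h4 | h4 | h4 <;> lia
    · rw [show R'.val N j = 0 by lia]
      have := h.grow_eq (by lia) (by lia)
      clear h2
      rcases h3 with h3 | h3 | h3 | h3 <;> rcases h4 with h4 | h4 | h4 | h4 <;> lia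
  · by_cases hj : j = R'.K
    · rw [show R'.val N j = R'.o by lia]
      have := h.second_iff (by lia) (by lia)
      clear h2
      rcases h3 with h3 | h3 | h3 | h3 <;> rcases h4 with h4 | h4 | h4 | h4 <;> lia
    · rw [show R'.val N j = j + R'.c by lia, show Y.val N j = N + 1 by lia]
      clear h2 h4
      have a8 := h.c_le_one
      by_cases hc : R'.c < R.c ∧ R'.K + 1 < R.S
      · have := h.shift hc.1 hc.2
        rcases h3 with h3 | h3 | h3 | h3 <;> lia
      · rcases h3 with h3 | h3 | h3 | h3 <;> lia

/-- The rule is local, so it is checked one row at a time. Above row 0 stands a fictitious row X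
which is 0 in all columns before `(R' 0).S`, where the values of row 0 can drop. -/
theorem slideStep_of_rowStep {R R' : ℕ → RowData}
    (h0 : ∀ X : RowData, (R' 0).S ≤ X.K → RowStep N X (R 0) (R' 0) (R' (0 + 1)))
    (h : ∀ i, RowStep N (R i) (R (i + 1)) (R' (i + 1)) (R' (i + 1 + 1))) :
    SlideStep (N + 1) (fun i => (R i).val N) (fun i => (R' i).val N) where
  le i j := by
    rcases i with _ | i
    · exact (h0 ⟨_, 0, 0, 0⟩ le_rfl).val_le j
    · exact (h i).val_le j
  eq_max i j hlt := by
    have hl : (j = 0 ∧ leftOf (fun i => (R i).val N) i j = 0) ∨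
        ∃ j', j = j' + 1 ∧ leftOf (fun i => (R i).val N) i j = (R i).val N j' := by
      rcases j with _ | j
      · exact Or.inl ⟨rfl, rfl⟩
      · exact Or.inr ⟨j, rfl, rfl⟩
    rcases i with _ | i
    · obtain ⟨h1, h2⟩ := (h0 ⟨_, 0, 0, 0⟩ le_rfl).val_eq_max hlt hl
      rw [h2]
      congr 1
      exact if_pos h1
    · exact ((h i).val_eq_max hlt hl).2
  lt_iff i j hpos hN := by
    rcases i with _ | i
    · exact (h0 ⟨_, 0, 0, 0⟩ le_rfl).val_lt_iff hpos hN
    · exact (h i).val_lt_iff hpos hN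

end

/-! ### Shapes given by row ends, and the explicit rows of the growth diagram -/

structure IsShape (a : ℕ → ℕ) : Prop where
  le (i : ℕ) : i ≤ a i
  succ (i : ℕ) : a (i + 1) ≤ a i ∨ a (i + 1) ≤ i + 1

/-- Row ends are absolute columns, so a strict partition becomes a weakly decreasing sequence down
to the empty rows `a i = i`. The field `succ` puts a new box below a box of a; with `le_succ` this
gives at most one new box in each row and column. -/
structure RookStrip (a b : ℕ → ℕ) : Prop where
  le (i : ℕ) : a i ≤ b i
  le_succ (i : ℕ) : b i ≤ a i + 1
  succ (i : ℕ) : b (i + 1) ≤ a (i + 1) ∨ b (i + 1) ≤ a i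

theorem RookStrip.dichotomy {a b : ℕ → ℕ} (ha : IsShape a) (hb : IsShape b) (h : RookStrip a b)
    (i : ℕ) : (a i = i ∧ a (i + 1) = i + 1 ∧ b (i + 1) = i + 1) ∨ (i < a i ∧ b (i + 1) ≤ a i) := by
  have := ha.le i
  have := hb.le (i + 1)
  have := ha.le (i + 1)
  have := ha.succ i
  have := h.succ i
  have := h.le (i + 1)
  omega

theorem RookStrip.skewEnd_cases {a b : ℕ → ℕ} (ha : IsShape a) (hb : IsShape b)
    (h : RookStrip a b) {N : ℕ} (hN : b 0 < N) (i : ℕ) :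
    b i < skewEnd N a i ∨ (a i = i ∧ b i = i ∧ skewEnd N a i = i) := by
  have := h.le 0
  have := ha.le 0
  rcases i with _ | i
  · simp only [skewEnd]; omega
  · have := h.dichotomy ha hb i
    have := h.le i
    simp only [skewEnd]; omega

theorem IsShape.le_zero {a : ℕ → ℕ} (ha : IsShape a) (i : ℕ) : a i ≤ a 0 ∨ a i = i := by
  induction i with
  | zero => exact Or.inl le_rfl
  | succ i ih =>
    have := ha.le (i + 1)
    have := ha.le i
    have := ha.succ i
    omega

theorem IsShape.skewEnd_le {a : ℕ → ℕ} (ha : IsShape a) {N : ℕ} (hN : a 0 < N) (M i : ℕ) :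
    (i = 0 ∧ skewEnd M a i = M) ∨ (0 < i ∧ skewEnd M a i ≤ N) ∨ (0 < i ∧ skewEnd M a i = i) := by
  rcases i with _ | i
  · simp [skewEnd]
  · have := ha.le_zero i
    simp only [skewEnd]
    omega

theorem IsShape.anti {a : ℕ → ℕ} (ha : IsShape a) {i i' : ℕ} (h : i ≤ i') :
    a i' ≤ a i ∨ a i' = i' := by
  induction i', h using Nat.le_induction with
  | base => exact Or.inl le_rfl
  | succ k hk ih =>
    have := ha.le (k + 1)
    have := ha.le k
    have := ha.succ k
    omega

/-- The rows of the growth diagram before the insertion starts. -/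
def preRow (N : ℕ) (a : ℕ → ℕ) (i : ℕ) : RowData := ⟨a i, skewEnd N a i, i + 1, 1⟩

/-- The rows of the growth diagram while a letter is inserted into row `p`. -/
def rowRow (N : ℕ) (a K : ℕ → ℕ) (p i : ℕ) : RowData :=
  ⟨K i, skewEnd (N + 1) a i, if i = p ∧ K i = p then p else i + 1, if i ≤ p then 0 else 1⟩

/-- The rows of the growth diagram while a letter is inserted into column `s`. -/
def colRow (N : ℕ) (a K : ℕ → ℕ) (s i : ℕ) : RowData :=
  ⟨K i, skewEnd (N + 1) a i, if K i = a i then if K i ≤ s then i else i + 1 else K i, 0⟩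

def preLabel (N : ℕ) (a : ℕ → ℕ) (i : ℕ) : ℕ → ℕ := (preRow N a i).val N

def rowLabel (N : ℕ) (a K : ℕ → ℕ) (p i : ℕ) : ℕ → ℕ := (rowRow N a K p i).val N

def colLabel (N : ℕ) (a K : ℕ → ℕ) (s i : ℕ) : ℕ → ℕ := (colRow N a K s i).val N

theorem preRow_spec (N : ℕ) (a : ℕ → ℕ) (i : ℕ) : (preRow N a i).K = a i ∧
    (preRow N a i).S = skewEnd N a i ∧ (preRow N a i).o = i + 1 ∧ (preRow N a i).c = 1 :=
  ⟨rfl, rfl, rfl, rfl⟩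

theorem rowRow_spec (N : ℕ) (a K : ℕ → ℕ) (p i : ℕ) : (rowRow N a K p i).K = K i ∧
    (rowRow N a K p i).S = skewEnd (N + 1) a i ∧
    ((i = p ∧ K i = p ∧ (rowRow N a K p i).o = p) ∨
      (¬ (i = p ∧ K i = p) ∧ (rowRow N a K p i).o = i + 1)) ∧
    ((i ≤ p ∧ (rowRow N a K p i).c = 0) ∨ (p < i ∧ (rowRow N a K p i).c = 1)) := by
  refine ⟨rfl, rfl, ?_, ?_⟩ <;> simp only [rowRow] <;> split_ifs <;> omega

theorem colRow_spec (N : ℕ) (a K : ℕ → ℕ) (s i : ℕ) : (colRow N a K s i).K = K i ∧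
    (colRow N a K s i).S = skewEnd (N + 1) a i ∧ (colRow N a K s i).c = 0 ∧
    ((K i ≠ a i ∧ (colRow N a K s i).o = K i) ∨ (K i = a i ∧ K i ≤ s ∧ (colRow N a K s i).o = i) ∨
      (K i = a i ∧ s < K i ∧ (colRow N a K s i).o = i + 1)) := by
  refine ⟨rfl, rfl, rfl, ?_⟩
  simp only [colRow]
  split_ifs <;> omega

/-- Here K exceeds a in row p exactly when the inserted letter finds its place there. The field
`nondiag` reflects that row p was reached by bumping off the diagonal; `zero` holds because a letter
inserted into an empty first row always finds its place. -/
structure RowState (a K : ℕ → ℕ) (p : ℕ) : Prop where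
  eq (i : ℕ) (h : i ≠ p) : K i = a i
  le : a p ≤ K p
  le_succ : K p ≤ a p + 1
  up (i : ℕ) (h : p = i + 1) : K p ≤ a i
  nondiag (i : ℕ) (h : i < p) : p + 1 ≤ a i
  zero : 1 ≤ K 0

/-- Column insertion starts right of a bumped diagonal box, so the rows from s on are still empty
(`diag`). The first row has a smaller letter in column s - 1, so its box in column s is free only
until the inserted letter takes it; hence `zero`. -/
structure ColState (a K : ℕ → ℕ) (s : ℕ) : Prop where
  pos : 1 ≤ s
  diag (i : ℕ) (h : s ≤ i) : a i = i
  eq (i : ℕ) : K i = a i ∨ (K i = s + 1 ∧ a i = s)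
  up (i : ℕ) : K (i + 1) = a (i + 1) ∨ s < a i
  zero : s + 1 ≤ K 0

theorem RowState.lt_skewEnd {a K : ℕ → ℕ} {p N : ℕ} (hK : RowState a K p) (hN : a 0 < N) :
    K p < skewEnd (N + 1) a p := by
  have := hK.le_succ
  rcases p with _ | p
  · simp only [skewEnd]; omega
  · have := hK.up p rfl
    simp only [skewEnd]; omega

theorem ColState.lt_skewEnd {a K : ℕ → ℕ} {s N : ℕ} (hK : ColState a K s)
    (hN : a 0 < N) (i : ℕ) : K i = a i ∨ K i < skewEnd (N + 1) a i := by
  have := hK.eq i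
  rcases i with _ | i
  · simp only [skewEnd]; omega
  · have := hK.up i
    simp only [skewEnd]; omega

/-! ### The local rule for each kind of transition -/

section

variable {N p s : ℕ} {a b K K' : ℕ → ℕ}

theorem slideStep_pre (ha : IsShape a) (hb : IsShape b) (h : RookStrip a b) (hN : b 0 < N) :
    SlideStep (N + 1) (preLabel N a) (preLabel N b) := by
  refine slideStep_of_rowStep (fun X hX => ?_) fun i => ?_
  · have := h.le 0
    have := h.le_succ 0
    have h3 := h.dichotomy ha hb 0
    have e1 := preRow_spec N a 0
    have e2 := preRow_spec N b 0
    have e3 := preRow_spec N b (0 + 1)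
    rw [skewEnd_zero] at e1 e2
    rw [skewEnd_succ] at e3
    constructor <;> lia
  · have := h.le i
    have := h.le_succ i
    have := h.le (i + 1)
    have := h.le_succ (i + 1)
    have := hb.le_zero i
    have := h.skewEnd_cases ha hb hN i
    have h3 := h.dichotomy ha hb i
    have h4 := h.dichotomy ha hb (i + 1)
    have e0 := preRow_spec N a i
    have e1 := preRow_spec N a (i + 1)
    have e2 := preRow_spec N b (i + 1)
    have e3 := preRow_spec N b (i + 1 + 1)
    rw [skewEnd_succ] at e1 e2 e3
    constructor <;> lia

theorem RowState.row_lt (h : RowState a K p) {i : ℕ} (hi : i < p) :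
    (rowRow N a K p i).K = a i ∧ (rowRow N a K p i).S = skewEnd (N + 1) a i ∧
    (rowRow N a K p i).o = i + 1 ∧ (rowRow N a K p i).c = 0 ∧ p + 1 ≤ a i := by
  have := rowRow_spec N a K p i
  have := h.eq i hi.ne
  have := h.nondiag i hi
  omega

theorem RowState.row_gt (h : RowState a K p) {i : ℕ} (hi : p < i) :
    (rowRow N a K p i).K = a i ∧ (rowRow N a K p i).S = skewEnd (N + 1) a i ∧
    (rowRow N a K p i).o = i + 1 ∧ (rowRow N a K p i).c = 1 := by
  have := rowRow_spec N a K p i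
  have := h.eq i hi.ne'
  omega

theorem RowState.row_self (h : RowState a K p) :
    (rowRow N a K p p).K = K p ∧ (rowRow N a K p p).S = skewEnd (N + 1) a p ∧
    (rowRow N a K p p).c = 0 ∧ a p ≤ K p ∧ K p ≤ a p + 1 ∧
    ((K p = p ∧ (rowRow N a K p p).o = p) ∨ (K p ≠ p ∧ (rowRow N a K p p).o = p + 1)) := by
  have := rowRow_spec N a K p p
  have := h.le
  have := h.le_succ
  omega

/-- The hypothesis `hs` is the placement rule for the inserted letter x in the first row: x can
follow the labels less than x there, unless the row already contains x. -/
theorem slideStep_start (ha : IsShape a) (hb : IsShape b) (h : RookStrip a b) (hN : b 0 < N)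
    (hK' : RowState b K' 0) (hs : K' 0 = b 0 + 1 ↔ b 0 = a 0) :
    SlideStep (N + 1) (preLabel N a) (rowLabel N b K' 0) := by
  refine slideStep_of_rowStep (fun X hX => ?_) fun i => ?_
  · have := h.le 0
    have := h.le_succ 0
    have h3 := h.dichotomy ha hb 0
    have e1 := preRow_spec N a 0
    have e2 := hK'.row_self (N := N)
    have e3 := hK'.row_gt (N := N) (show 0 < 0 + 1 by omega)
    have := hK'.zero
    rw [skewEnd_zero] at e1 e2
    rw [skewEnd_succ] at e3
    constructor <;> lia
  · have := h.le i
    have := h.le_succ i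
    have := h.le (i + 1)
    have := h.le_succ (i + 1)
    have := hb.le_zero i
    have := h.skewEnd_cases ha hb hN i
    have h3 := h.dichotomy ha hb i
    have h4 := h.dichotomy ha hb (i + 1)
    have e0 := preRow_spec N a i
    have e1 := preRow_spec N a (i + 1)
    have e2 := hK'.row_gt (N := N) (show 0 < i + 1 by omega)
    have e3 := hK'.row_gt (N := N) (show 0 < i + 1 + 1 by omega)
    rw [skewEnd_succ] at e1 e2 e3
    constructor <;> lia

theorem slideStep_row_stay (ha : IsShape a) (hb : IsShape b) (h : RookStrip a b) (hN : b 0 < N)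
    (hK : RowState a K p) (hK' : RowState b K' p) (hp : b p = a p) (hs : K' p = K p) :
    SlideStep (N + 1) (rowLabel N a K p) (rowLabel N b K' p) := by
  refine slideStep_of_rowStep (fun X hX => ?_) fun i => ?_
  · have := h.le 0
    have := h.le_succ 0
    have h3 := h.dichotomy ha hb 0
    have h5 : p = 0 ∨ p = 0 + 1 ∨ 0 + 1 < p := by omega
    rcases h5 with rfl | rfl | h5
    · have e1 := hK.row_self (N := N)
      have e2 := hK'.row_self (N := N)
      have e3 := hK'.row_gt (N := N) (show 0 < 0 + 1 by omega)
      have := hK.zero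
      rw [skewEnd_zero] at e1 e2
      rw [skewEnd_succ] at e3
      constructor <;> lia
    · have e1 := hK.row_lt (N := N) (show 0 < 0 + 1 by omega)
      have e2 := hK'.row_lt (N := N) (show 0 < 0 + 1 by omega)
      have e3 := hK'.row_self (N := N)
      have := hK.up 0 rfl
      rw [skewEnd_zero] at e1 e2
      rw [skewEnd_succ] at e3
      constructor <;> lia
    · have e1 := hK.row_lt (N := N) (show 0 < p by omega)
      have e2 := hK'.row_lt (N := N) (show 0 < p by omega)
      have e3 := hK'.row_lt (N := N) h5
      rw [skewEnd_zero] at e1 e2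
      rw [skewEnd_succ] at e3
      constructor <;> lia
  · have := h.le i
    have := h.le_succ i
    have := h.le (i + 1)
    have := h.le_succ (i + 1)
    have := hb.le_zero i
    have := h.skewEnd_cases ha hb (N := N + 1) (by omega) i
    have h3 := h.dichotomy ha hb i
    have h4 := h.dichotomy ha hb (i + 1)
    have h5 : p < i ∨ p = i ∨ p = i + 1 ∨ p = i + 1 + 1 ∨ i + 1 + 1 < p := by omega
    rcases h5 with h5 | rfl | rfl | rfl | h5
    · have e0 := hK.row_gt (N := N) h5
      have e1 := hK.row_gt (N := N) (show p < i + 1 by omega)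
      have e2 := hK'.row_gt (N := N) (show p < i + 1 by omega)
      have e3 := hK'.row_gt (N := N) (show p < i + 1 + 1 by omega)
      rw [skewEnd_succ] at e1 e2 e3
      constructor <;> lia
    · have e0 := hK.row_self (N := N)
      have e1 := hK.row_gt (N := N) (show p < p + 1 by omega)
      have e2 := hK'.row_gt (N := N) (show p < p + 1 by omega)
      have e3 := hK'.row_gt (N := N) (show p < p + 1 + 1 by omega)
      rw [skewEnd_succ] at e1 e2 e3
      constructor <;> lia
    · have e0 := hK.row_lt (N := N) (show i < i + 1 by omega)
      have e1 := hK.row_self (N := N)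
      have e2 := hK'.row_self (N := N)
      have e3 := hK'.row_gt (N := N) (show i + 1 < i + 1 + 1 by omega)
      have := hK.up i rfl
      rw [skewEnd_succ] at e1 e2 e3
      constructor <;> lia
    · have e0 := hK.row_lt (N := N) (show i < i + 1 + 1 by omega)
      have e1 := hK.row_lt (N := N) (show i + 1 < i + 1 + 1 by omega)
      have e2 := hK'.row_lt (N := N) (show i + 1 < i + 1 + 1 by omega)
      have e3 := hK'.row_self (N := N)
      have := hK.up (i + 1) rfl
      rw [skewEnd_succ] at e1 e2 e3
      constructor <;> lia
    · have e0 := hK.row_lt (N := N) (show i < p by omega)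
      have e1 := hK.row_lt (N := N) (show i + 1 < p by omega)
      have e2 := hK'.row_lt (N := N) (show i + 1 < p by omega)
      have e3 := hK'.row_lt (N := N) h5
      rw [skewEnd_succ] at e1 e2 e3
      constructor <;> lia

theorem ColState.row_cases (h : ColState a K s) (i : ℕ) :
    (colRow N a K s i).S = skewEnd (N + 1) a i ∧ (colRow N a K s i).c = 0 ∧
    (colRow N a K s i).K = K i ∧
    ((K i = a i ∧ a i ≤ s ∧ (colRow N a K s i).o = i) ∨
      (K i = a i ∧ s < a i ∧ (colRow N a K s i).o = i + 1) ∨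
      (K i = s + 1 ∧ a i = s ∧ (colRow N a K s i).o = s + 1)) := by
  have := colRow_spec N a K s i
  have := h.eq i
  omega


-- The label r + 1 is bumped from row p off the diagonal. By `hs` it finds its place in row p + 1
-- exactly when its left neighbour there is not already r + 1 and the box above has a label at most
-- r after the placement in row p.
set_option maxHeartbeats 2000000 in
theorem slideStep_row_row (ha : IsShape a) (hb : IsShape b) (h : RookStrip a b) (hN : b 0 < N)
    (hK : RowState a K p) (hK' : RowState b K' (p + 1)) (hp : b p = a p + 1) (hd : p < a p)
    (hs : K' (p + 1) = b (p + 1) + 1 ↔ b (p + 1) ≤ a (p + 1) ∧ b (p + 1) < K p) :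
    SlideStep (N + 1) (rowLabel N a K p) (rowLabel N b K' (p + 1)) := by
  -- Since `K' (p + 1)` is `b (p + 1)` or one more, the equivalence `hs` becomes a disjunction of
  -- linear conditions.
  have hs' : (K' (p + 1) = b (p + 1) + 1 ∧ b (p + 1) ≤ a (p + 1) ∧ b (p + 1) < K p) ∨
      (K' (p + 1) = b (p + 1) ∧ (a (p + 1) < b (p + 1) ∨ K p ≤ b (p + 1))) := by
    have := hK'.le
    have := hK'.le_succ
    omega
  clear hs
  refine slideStep_of_rowStep (fun X hX => ?_) fun i => ?_
  · have := h.le 0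
    have := h.le_succ 0
    have h3 := h.dichotomy ha hb 0
    rcases Nat.eq_zero_or_pos p with rfl | h5
    · have e1 := hK.row_self (N := N)
      have e2 := hK'.row_lt (N := N) (show 0 < 0 + 1 by omega)
      have e3 := hK'.row_self (N := N)
      have := hK.zero
      rw [skewEnd_zero] at e1 e2
      rw [skewEnd_succ] at e3
      constructor <;> lia (splits := 40)
    · have e1 := hK.row_lt (N := N) h5
      have e2 := hK'.row_lt (N := N) (show 0 < p + 1 by omega)
      have e3 := hK'.row_lt (N := N) (show 0 + 1 < p + 1 by omega)
      rw [skewEnd_zero] at e1 e2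
      rw [skewEnd_succ] at e3
      constructor <;> lia (splits := 40)
  · have := h.le i
    have := h.le_succ i
    have := h.le (i + 1)
    have := h.le_succ (i + 1)
    have := hb.le_zero i
    have h6 := h.skewEnd_cases ha hb (N := N + 1) (by omega) i
    have h3 := h.dichotomy ha hb i
    have h4 := h.dichotomy ha hb (i + 1)
    have h5 : p < i ∨ p = i ∨ p = i + 1 ∨ i + 1 < p := by omega
    rcases h5 with h5 | rfl | rfl | h5
    · clear hs'
      have e0 := hK.row_gt (N := N) h5
      have e1 := hK.row_gt (N := N) (show p < i + 1 by omega)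
      have e2 := hK'.row_gt (N := N) (show p + 1 < i + 1 by omega)
      have e3 := hK'.row_gt (N := N) (show p + 1 < i + 1 + 1 by omega)
      rw [skewEnd_succ] at e1 e2 e3
      constructor <;> lia (splits := 40)
    · have e0 := hK.row_self (N := N)
      have e1 := hK.row_gt (N := N) (show p < p + 1 by omega)
      have e2 := hK'.row_self (N := N)
      have e3 := hK'.row_gt (N := N) (show p + 1 < p + 1 + 1 by omega)
      rw [skewEnd_succ] at e1 e2 e3
      have h3 := h3.resolve_left (by omega)
      have h6 := h6.resolve_right (by omega)
      rcases hs' with hs' | hs' <;> constructor <;> lia (splits := 40)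
    · have e0 := hK.row_lt (N := N) (show i < i + 1 by omega)
      have e1 := hK.row_self (N := N)
      have e2 := hK'.row_lt (N := N) (show i + 1 < i + 1 + 1 by omega)
      have e3 := hK'.row_self (N := N)
      have := hK.up i rfl
      rw [skewEnd_succ] at e1 e2 e3
      have h3 := h3.resolve_left (by omega)
      have h4 := h4.resolve_left (by omega)
      have h6 := h6.resolve_right (by omega)
      have e1' := e1.2.2.2.2.2.resolve_left (by omega)
      rcases hs' with hs' | ⟨hs', hs'' | hs''⟩ <;> constructor <;> lia (splits := 40)
    · clear hs'
      have h3 := h3.resolve_left (by have := hK.nondiag i (by omega); omega)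
      have h4 := h4.resolve_left (by have := hK.nondiag (i + 1) (by omega); omega)
      have e0 := hK.row_lt (N := N) (show i < p by omega)
      have e1 := hK.row_lt (N := N) h5
      have e2 := hK'.row_lt (N := N) (show i + 1 < p + 1 by omega)
      have e3 := hK'.row_lt (N := N) (show i + 1 + 1 < p + 1 by omega)
      rw [skewEnd_succ] at e1 e2 e3
      constructor <;> lia (splits := 40)

-- The bumped box is the diagonal box (p, p). The label r + 1 enters column p + 1, and in `hs` it
-- takes a box there exactly when the left and upper neighbours have smaller labels.
set_option maxHeartbeats 2000000 in
theorem slideStep_row_col (ha : IsShape a) (hb : IsShape b) (h : RookStrip a b) (hN : b 0 < N)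
    (hK : RowState a K p) (hK' : ColState b K' (p + 1)) (hp : b p = p + 1) (hd : a p = p)
    (hs : ∀ i, b i = p + 1 → i ≤ p →
      (K' i = p + 2 ↔ p + 1 ≤ K i ∧ ∀ i', i = i' + 1 → p + 1 < K i')) :
    SlideStep (N + 1) (rowLabel N a K p) (colLabel N b K' (p + 1)) := by
  -- The first row has no upper neighbour; treating it separately removes the quantifier over the
  -- preceding row from `hs`.
  have hs0 : b 0 = p + 1 → (K' 0 = p + 2 ↔ p + 1 ≤ K 0) := fun h0 => by simp [hs 0 h0]
  have hs1 : ∀ i, b (i + 1) = p + 1 → i + 1 ≤ p →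
      (K' (i + 1) = p + 2 ↔ p + 1 ≤ K (i + 1) ∧ p + 1 < K i) := fun i h1 h2 => by
    simp [hs (i + 1) h1 h2]
  have hbp : ∀ k ≤ p, p + 1 ≤ b k := fun k hk => by
    have := hb.anti hk
    omega
  refine slideStep_of_rowStep (fun X hX => ?_) fun i => ?_
  · have := h.le 0
    have := h.le_succ 0
    have h3 := h.dichotomy ha hb 0
    have e2 := hK'.row_cases (N := N) 0
    have e3 := hK'.row_cases (N := N) (0 + 1)
    have := hK'.up 0
    have := hK'.zero
    rw [skewEnd_zero] at e2
    rw [skewEnd_succ] at e3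
    rcases Nat.eq_zero_or_pos p with rfl | h5
    · have e1 := hK.row_self (N := N)
      have := hK.zero
      have := hs0 hp
      rw [skewEnd_zero] at e1
      clear hs hs0 hs1 hbp
      constructor <;> lia (splits := 40)
    · have e1 := hK.row_lt (N := N) h5
      have := hs1 0
      have := hK.eq 0 (by omega)
      have := hbp (0 + 1) (by omega)
      rw [skewEnd_zero] at e1
      clear hs hs0 hs1 hbp
      constructor <;> lia (splits := 40)
  · have := h.le i
    have := h.le_succ i
    have := h.le (i + 1)
    have := h.le_succ (i + 1)
    have := hb.le_zero i
    have h6 := h.skewEnd_cases ha hb (N := N + 1) (by omega) i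
    have h3 := h.dichotomy ha hb i
    have h4 := h.dichotomy ha hb (i + 1)
    have h5 : p < i ∨ p = i ∨ p = i + 1 ∨ i + 1 < p := by omega
    have e2 := hK'.row_cases (N := N) (i + 1)
    have e3 := hK'.row_cases (N := N) (i + 1 + 1)
    have := hK'.up i
    have := hK'.up (i + 1)
    rw [skewEnd_succ] at e2 e3
    clear hs hs0
    rcases h5 with h5 | rfl | rfl | h5
    · have e0 := hK.row_gt (N := N) h5
      have e1 := hK.row_gt (N := N) (show p < i + 1 by omega)
      have := hK'.diag i h5
      have := hK'.diag (i + 1) (by omega)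
      have := hK'.diag (i + 1 + 1) (by omega)
      rw [skewEnd_succ] at e1
      clear hs1 hbp
      constructor <;> lia (splits := 40)
    · have e0 := hK.row_self (N := N)
      have e1 := hK.row_gt (N := N) (show p < p + 1 by omega)
      have := hK'.diag (p + 1) (by omega)
      have := hK'.diag (p + 1 + 1) (by omega)
      rw [skewEnd_succ] at e1
      clear hs1 hbp
      constructor <;> lia (splits := 40)
    · have e0 := hK.row_lt (N := N) (show i < i + 1 by omega)
      have e1 := hK.row_self (N := N)
      have := hK'.diag (i + 1 + 1) (by omega)
      have := hK.up i rfl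
      have h7 := hs1 i hp le_rfl
      rw [hK.eq i (by omega)] at h7
      rw [skewEnd_succ] at e1
      have h3 := h3.resolve_left (by omega)
      have h6 := h6.resolve_right (by omega)
      clear hs1 hbp
      by_cases h8 : K' (i + 1) = i + 1 + 2
      · constructor <;> lia (splits := 40)
      · constructor <;> lia (splits := 40)
    · have e0 := hK.row_lt (N := N) (show i < p by omega)
      have e1 := hK.row_lt (N := N) h5
      have := hbp (i + 1 + 1) (by omega)
      have h7 := hs1 i
      rw [hK.eq i (by omega), hK.eq (i + 1) (by omega)] at h7
      have h8 := hs1 (i + 1)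
      rw [hK.eq (i + 1) (by omega)] at h8
      rw [skewEnd_succ] at e1
      have h3 := h3.resolve_left (by omega)
      have h4 := h4.resolve_left (by omega)
      have h6 := h6.resolve_right (by omega)
      clear hs1 hbp
      by_cases h9 : b (i + 1) = p + 1
      · have h7 := h7 h9 (by omega)
        by_cases h10 : K' (i + 1) = p + 2
        · constructor <;> lia (splits := 40)
        · constructor <;> lia (splits := 40)
      · clear h7
        constructor <;> lia (splits := 40)

-- By `hp` no new box lies in column s. Outside that column rows may grow, which is why K' is a
-- maximum.
set_option maxHeartbeats 2000000 in
theorem slideStep_col_stay (ha : IsShape a) (hb : IsShape b) (h : RookStrip a b) (hN : b 0 < N)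
    (hK : ColState a K s) (hK' : ColState b K' s) (hp : ∀ i, a i = s → b i = s)
    (hs : ∀ i, K' i = max (K i) (b i)) :
    SlideStep (N + 1) (colLabel N a K s) (colLabel N b K' s) := by
  refine slideStep_of_rowStep (fun X hX => ?_) fun i => ?_
  · have := h.le 0
    have := h.le_succ 0
    have h3 := h.dichotomy ha hb 0
    have := hK.pos
    have e1 := hK.row_cases (N := N) 0
    have e2 := hK'.row_cases (N := N) 0
    have e3 := hK'.row_cases (N := N) (0 + 1)
    have := hK.zero
    have := hK'.up 0
    have := hp 0
    have := hs 0
    clear hs hp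
    rw [skewEnd_zero] at e1 e2
    rw [skewEnd_succ] at e3
    constructor <;> lia (splits := 40)
  · have := h.le i
    have := h.le_succ i
    have := h.le (i + 1)
    have := h.le_succ (i + 1)
    have := hb.le_zero i
    have := h.skewEnd_cases ha hb (N := N + 1) (by omega) i
    have h3 := h.dichotomy ha hb i
    have := hK.pos
    have h4 := h.dichotomy ha hb (i + 1)
    have e0 := hK.row_cases (N := N) i
    have e1 := hK.row_cases (N := N) (i + 1)
    have e2 := hK'.row_cases (N := N) (i + 1)
    have e3 := hK'.row_cases (N := N) (i + 1 + 1)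
    have := hK.up i
    have := hK'.up (i + 1)
    have := hp i
    have := hp (i + 1)
    have h7 := hs (i + 1)
    have := hb.le (i + 1 + 1)
    have h8 := hK.diag i
    have h9 := hK'.diag i
    rw [skewEnd_succ] at e1 e2 e3
    clear hs hp
    obtain ⟨e1, e1', e1'', e4⟩ := e1
    rcases h3 with h3 | h3
    · constructor <;> lia (splits := 40)
    · rcases e4 with e4 | e4 | e4 <;> constructor <;> lia (splits := 40)

set_option maxHeartbeats 2000000 in
theorem slideStep_col_col {f : ℕ} (ha : IsShape a) (hb : IsShape b) (h : RookStrip a b)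
    (hN : b 0 < N) (hK : ColState a K s) (hK' : ColState b K' (s + 1)) (hf : a f = s)
    (hf' : b f = s + 1)
    (hs : ∀ i, b i = s + 1 → i ≤ s →
      (K' i = s + 2 ↔ s + 1 ≤ K i ∧ ∀ i', i = i' + 1 → s + 1 < K i')) :
    SlideStep (N + 1) (colLabel N a K s) (colLabel N b K' (s + 1)) := by
  have hs0 : b 0 = s + 1 → (K' 0 = s + 2 ↔ s + 1 ≤ K 0) := fun h0 => by simp [hs 0 h0]
  have hs1 : ∀ i, b (i + 1) = s + 1 → i + 1 ≤ s →
      (K' (i + 1) = s + 2 ↔ s + 1 ≤ K (i + 1) ∧ s + 1 < K i) := fun i h1 h2 => by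
    simp [hs (i + 1) h1 h2]
  have hfs : f ≤ s := hf ▸ ha.le f
  -- The box (f, s) is new, so the box above it is old, and therefore all earlier rows already reach
  -- past column s.
  have hl : ∀ i, i < f → s < a i := by
    intro i hi
    obtain ⟨f, rfl⟩ : ∃ f', f = f' + 1 := ⟨f - 1, by omega⟩
    have := h.succ f
    have := ha.anti (show i ≤ f by omega)
    omega
  have hg : ∀ i, f ≤ i → a i ≤ s ∨ a i = i := fun i hi => hf ▸ ha.anti hi
  have hbf : ∀ k ≤ f, s + 1 ≤ b k := fun k hk => by
    have := hb.anti hk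
    omega
  refine slideStep_of_rowStep (fun X hX => ?_) fun i => ?_
  · have := h.le 0
    have := h.le_succ 0
    have h3 := h.dichotomy ha hb 0
    have := hK.pos
    clear hs
    have e1 := hK.row_cases (N := N) 0
    have e2 := hK'.row_cases (N := N) 0
    have e3 := hK'.row_cases (N := N) (0 + 1)
    have := hK.zero
    have := hK'.zero
    have := hK'.up 0
    have := hl 0
    have := hs1 0
    rw [skewEnd_zero] at e1 e2
    rw [skewEnd_succ] at e3
    rcases Nat.eq_zero_or_pos f with rfl | h5
    · clear hl hg hbf hs0 hs1
      constructor <;> lia (splits := 40)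
    · have := hbf (0 + 1) (by omega)
      clear hl hg hbf hs0 hs1
      constructor <;> lia (splits := 40)
  · have := h.le i
    have := h.le_succ i
    have := h.le (i + 1)
    have := h.le_succ (i + 1)
    have := hb.le_zero i
    have := h.skewEnd_cases ha hb (N := N + 1) (by omega) i
    have h3 := h.dichotomy ha hb i
    have := hK.pos
    clear hs hs0
    have h4 := h.dichotomy ha hb (i + 1)
    have e0 := hK.row_cases (N := N) i
    have e1 := hK.row_cases (N := N) (i + 1)
    have e2 := hK'.row_cases (N := N) (i + 1)
    have e3 := hK'.row_cases (N := N) (i + 1 + 1)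
    have := hK.up i
    have := hK'.up i
    have := hK'.up (i + 1)
    have := hK.diag i
    have := hK'.diag i
    have := hs1 i
    rw [skewEnd_succ] at e1 e2 e3
    have h5 : f < i ∨ f = i ∨ f = i + 1 ∨ i + 1 < f := by omega
    obtain ⟨e1, e1', e1'', e4⟩ := e1
    rcases h5 with h5 | rfl | rfl | h5
    · have := hg i h5.le
      have := hg (i + 1) (by omega)
      clear hl hg hbf hs1
      rcases h3 with h3 | h3
      · constructor <;> lia (splits := 40)
      · rcases e4 with e4 | e4 | e4 <;> constructor <;> lia (splits := 40)
    · have := hg (f + 1) (by omega)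
      clear hl hg hbf hs1
      constructor <;> lia (splits := 40)
    · have := hl i (by omega)
      have := hs1 (i + 1)
      clear hl hg hbf hs1
      constructor <;> lia (splits := 40)
    · have := hl i (by omega)
      have := hl (i + 1) (by omega)
      have := hbf (i + 1 + 1) (by omega)
      have := hs1 (i + 1)
      clear hl hg hbf hs1
      rcases e4 with e4 | e4 | e4 <;> constructor <;> lia (splits := 40)

end

/-! ### Growth diagrams compute slides -/

structure IsIncr (M : ℕ) (U : ℕ → ℕ → ℕ) : Prop where
  le (i j : ℕ) : U i j ≤ M
  row (i j : ℕ) : U i j < U i (j + 1) ∨ (U i j = 0 ∧ U i (j + 1) = 0) ∨ (U i j = M ∧ U i (j + 1) = M)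
  col (i j : ℕ) (h : i < j) : U i j < U (i + 1) j ∨ (U i j = 0 ∧ U (i + 1) j = 0) ∨
    (U i j = M ∧ U (i + 1) j = M)
  below (i j : ℕ) (h : j < i) : U i j = 0

/-- A dropped value is at least its old left and upper neighbours. If it equals such a neighbour
with a value strictly between 0 and M, then `lt_iff` makes that neighbour drop as well, so
strictness survives. -/
theorem SlideStep.isIncr {M : ℕ} {U V : ℕ → ℕ → ℕ} (h : SlideStep M U V) (hU : IsIncr M U) :
    IsIncr M V where
  le i j := (h.le i j).trans (hU.le i j)
  row i j := by
    have h1 := h.le i j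
    have h2 := h.le i (j + 1)
    have h3 := h.eq_max i (j + 1)
    have h4 := h.lt_iff i j
    have h5 := hU.row i j
    have h6 := hU.le i j
    have h7 := hU.le i (j + 1)
    simp only [leftOf] at h3
    by_cases hV : V i (j + 1) < U i (j + 1)
    · have h8 := h3 hV
      have h9 : U i j ≤ V i (j + 1) := h8 ▸ le_max_left _ _
      by_cases h0 : 0 < U i j <;> by_cases hM : U i j < M
      · have := h4 h0 hM
        omega
      all_goals omega
    · omega
  col i j hij := by
    have h1 := h.le i j
    have h2 := h.le (i + 1) j
    have h3 := h.eq_max (i + 1) j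
    have h4 := h.lt_iff i j
    have h5 := hU.col i j hij
    have h6 := hU.le i j
    have h7 := hU.le (i + 1) j
    simp only [upOf] at h3
    by_cases hV : V (i + 1) j < U (i + 1) j
    · have h8 := h3 hV
      have h9 : U i j ≤ V (i + 1) j := h8 ▸ le_max_right _ _
      by_cases h0 : 0 < U i j <;> by_cases hM : U i j < M
      · have := h4 h0 hM
        omega
      all_goals omega
    · omega
  below i j hij := by
    have := h.le i j
    have := hU.below i j hij
    omega

theorem adjacent_right (i j : ℕ) : Adjacent (i, j) (i, j + 1) := Or.inl ⟨rfl, Or.inl rfl⟩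

theorem adjacent_down (i j : ℕ) : Adjacent (i, j) (i + 1, j) := Or.inr ⟨rfl, Or.inl rfl⟩

theorem Adjacent.symm {a b : Box} (h : Adjacent a b) : Adjacent b a := by
  unfold Adjacent at *
  omega

theorem adjacent_iff (i j : ℕ) (b : Box) : Adjacent (i, j) b ↔
    b = (i, j + 1) ∨ b = (i + 1, j) ∨ (∃ j', j = j' + 1 ∧ b = (i, j')) ∨
      ∃ i', i = i' + 1 ∧ b = (i', j) := by
  constructor
  · obtain ⟨b1, b2⟩ := b
    rintro (⟨h, h' | h'⟩ | ⟨h, h' | h'⟩) <;> simp only at h h' <;> subst h <;> subst h'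
    · exact Or.inl rfl
    · exact Or.inr (Or.inr (Or.inl ⟨_, rfl, rfl⟩))
    · exact Or.inr (Or.inl rfl)
    · exact Or.inr (Or.inr (Or.inr ⟨_, rfl, rfl⟩))
  · rintro (rfl | rfl | ⟨j', rfl, rfl⟩ | ⟨i', rfl, rfl⟩)
    · exact adjacent_right i j
    · exact adjacent_down i j
    · exact (adjacent_right i j').symm
    · exact (adjacent_down i' j).symm

/-- The box carries the passing label at level m and V there is the maximum of the left and upper
values of U. The right and lower neighbours exceed m, so a neighbour with value m must be one of
those two. -/
theorem SlideStep.eq_iff_adjacent {M m : ℕ} {U V : ℕ → ℕ → ℕ} (h : SlideStep M U V)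
    (hU : IsIncr M U) (hm : 0 < m) {i j : ℕ} (h1 : m < U i j) (h2 : V i j ≤ m) :
    V i j = m ↔ ∃ b : Box, Adjacent (i, j) b ∧ U b.1 b.2 = m := by
  have h3 := h.eq_max i j (by omega)
  simp only [adjacent_iff]
  constructor
  · intro h4
    rcases le_total (leftOf U i j) (upOf U i j) with h5 | h5
    · rw [max_eq_right h5] at h3
      rcases i with _ | i
      · simp only [upOf] at h3; omega
      · exact ⟨(i, j), Or.inr (Or.inr (Or.inr ⟨i, rfl, rfl⟩)), by simp only [upOf] at h3 ⊢; omega⟩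
    · rw [max_eq_left h5] at h3
      rcases j with _ | j
      · simp only [leftOf] at h3; omega
      · exact ⟨(i, j), Or.inr (Or.inr (Or.inl ⟨j, rfl, rfl⟩)), by simp only [leftOf] at h3 ⊢; omega⟩
  · rintro ⟨b, rfl | rfl | ⟨j', rfl, rfl⟩ | ⟨i', rfl, rfl⟩, hb⟩ <;> simp only at hb
    · have := hU.row i j
      have := hU.le i j
      omega
    · by_cases hij : i < j
      · have := hU.col i j hij
        have := hU.le i j
        omega
      · have := hU.below (i + 1) j (by omega)
        omega
    · simp only [leftOf] at h3
      have := le_max_left (U i j') (upOf U i (j' + 1))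
      omega
    · simp only [upOf] at h3
      have := le_max_right (leftOf U (i' + 1) j) (U i' j)
      omega

/-- Such a neighbour cannot be to the left or above, where U is smaller than m or 0. To the right or
below, its new value is at least `U i j` = m, hence m, and `lt_iff` applies. -/
theorem SlideStep.lt_iff_adjacent {M m : ℕ} {U V : ℕ → ℕ → ℕ} (h : SlideStep M U V)
    (hU : IsIncr M U) (hm : 0 < m) (hM : m < M) {i j : ℕ} (h1 : U i j = m) :
    V i j < m ↔ ∃ b : Box, Adjacent (i, j) b ∧ m < U b.1 b.2 ∧ V b.1 b.2 ≤ m := by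
  have h3 := h.lt_iff i j (by omega) (by omega)
  rw [h1] at h3
  rw [h3]
  simp only [adjacent_iff]
  constructor
  · rintro (h4 | h4)
    · refine ⟨(i, j + 1), Or.inl rfl, ?_, h4.le⟩
      have := hU.row i j
      simp only
      omega
    · refine ⟨(i + 1, j), Or.inr (Or.inl rfl), ?_, h4.le⟩
      simp only
      by_cases hij : i < j
      · have := hU.col i j hij
        omega
      · have := hU.below (i + 1) j (by omega)
        have := h.le (i + 1) j
        omega
  · rintro ⟨b, rfl | rfl | ⟨j', rfl, rfl⟩ | ⟨i', rfl, rfl⟩, hb, hb'⟩ <;> simp only at hb hb'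
    · have h5 := h.eq_max i (j + 1) (by omega)
      have := le_max_left (leftOf U i (j + 1)) (upOf U i (j + 1))
      simp only [leftOf] at *
      omega
    · have h5 := h.eq_max (i + 1) j (by omega)
      have := le_max_right (leftOf U (i + 1) j) (upOf U (i + 1) j)
      simp only [upOf] at *
      omega
    · have := hU.row i j'
      have := hU.le i j'
      omega
    · by_cases hij : i' < j
      · have := hU.col i' j hij
        have := hU.le i' j
        omega
      · have := hU.below (i' + 1) j (by omega)
        omega

/-- `F` is the filling whose label at a box is the first index `r` at which the value of `U` there
drops from above `m` to at most `m`. -/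
structure IsLevel (U : ℕ → ℕ → ℕ → ℕ) (q m : ℕ) (F : Filling ℕ) : Prop where
  zero (i j : ℕ) : F (i, j) ≠ some 0
  succ (i j r : ℕ) : F (i, j) = some (r + 1) ↔ r < q ∧ m < U r i j ∧ U (r + 1) i j ≤ m

theorem Filling.ext_of_eq_some {α : Type} {F G : Filling α} (h : ∀ b x, F b = some x ↔ G b = some x) :
    F = G := by
  funext b
  exact Option.ext fun x => h b x

theorem IsLevel.unique {U : ℕ → ℕ → ℕ → ℕ} {q m : ℕ} {F G : Filling ℕ} (hF : IsLevel U q m F)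
    (hG : IsLevel U q m G) : F = G := by
  refine Filling.ext_of_eq_some fun b x => ?_
  obtain ⟨i, j⟩ := b
  rcases x with _ | r
  · exact iff_of_false (hF.zero i j) (hG.zero i j)
  · rw [hF.succ, hG.succ]

/-- The slide from level m + 1 to level m after t switches: the circles are the boxes where `U t` is
m + 1, the labels up to t are already those of level m, and the larger ones are still those of level
m + 1. -/
structure IsSlideState (U : ℕ → ℕ → ℕ → ℕ) (q m t : ℕ) (S : Filling Label) : Prop where
  circ (i j : ℕ) : S (i, j) = some .circ ↔ U t i j = m + 1
  zero (i j : ℕ) : S (i, j) ≠ some (.num 0)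
  done (i j r : ℕ) (h : r < t) :
    S (i, j) = some (.num (r + 1)) ↔ r < q ∧ m < U r i j ∧ U (r + 1) i j ≤ m
  todo (i j r : ℕ) (h : t ≤ r) :
    S (i, j) = some (.num (r + 1)) ↔ r < q ∧ m + 1 < U r i j ∧ U (r + 1) i j ≤ m + 1

theorem switch_eq_circ {α : Type} {c d : α} (hcd : c ≠ d) (T : Filling α) (a : Box) :
    switch c d T a = some d ↔ (T a = some c ∧ ∃ b, Adjacent a b ∧ T b = some d) ∨
      (T a = some d ∧ ¬ ∃ b, Adjacent a b ∧ T b = some c) := by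
  unfold switch
  split_ifs with h1 h2
  · simp [h1]
  · have : T a ≠ some c := by rw [h2.1]; simpa using hcd.symm
    simp only [Option.some.injEq, hcd, false_iff]
    clear hcd
    generalize (∃ b, Adjacent a b ∧ T b = some c) = P at *
    generalize (∃ b, Adjacent a b ∧ T b = some d) = Q at *
    tauto
  · generalize (∃ b, Adjacent a b ∧ T b = some c) = P at *
    generalize (∃ b, Adjacent a b ∧ T b = some d) = Q at *
    tauto

theorem switch_eq_num {α : Type} {c d : α} (hcd : c ≠ d) (T : Filling α) (a : Box) :
    switch c d T a = some c ↔ (T a = some d ∧ ∃ b, Adjacent a b ∧ T b = some c) ∨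
      (T a = some c ∧ ¬ ∃ b, Adjacent a b ∧ T b = some d) := by
  unfold switch
  split_ifs with h1 h2
  · have : T a ≠ some d := by rw [h1.1]; simpa using hcd
    simp only [Option.some.injEq, hcd.symm, false_iff]
    clear hcd
    generalize (∃ b, Adjacent a b ∧ T b = some c) = P at *
    generalize (∃ b, Adjacent a b ∧ T b = some d) = Q at *
    tauto
  · simp [h2]
  · generalize (∃ b, Adjacent a b ∧ T b = some c) = P at *
    generalize (∃ b, Adjacent a b ∧ T b = some d) = Q at *
    tauto

theorem switch_eq_other {α : Type} {c d e : α} (hc : c ≠ e) (hd : d ≠ e) (T : Filling α)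
    (a : Box) : switch c d T a = some e ↔ T a = some e := by
  unfold switch
  split_ifs with h1 h2
  · simp [h1.1, hc, hd]
  · simp [h2.1, hc, hd]
  · rfl

theorem IsSlideState.switch {U : ℕ → ℕ → ℕ → ℕ} {N q m t : ℕ} {S : Filling Label}
    (h : IsSlideState U q m t S) (ht : t < q) (hm : m < N)
    (hU : SlideStep (N + 1) (U t) (U (t + 1))) (hI : IsIncr (N + 1) (U t)) :
    IsSlideState U q m (t + 1) (switch (.num (t + 1)) .circ S) where
  circ i j := by
    rw [switch_eq_circ (by simp)]
    have e1 := h.todo i j t le_rfl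
    have e2 : (∃ b, Adjacent (i, j) b ∧ S b = some .circ) ↔
        ∃ b : Box, Adjacent (i, j) b ∧ U t b.1 b.2 = m + 1 := by simp only [h.circ]
    have e3 : (∃ b, Adjacent (i, j) b ∧ S b = some (.num (t + 1))) ↔
        ∃ b : Box, Adjacent (i, j) b ∧ m + 1 < U t b.1 b.2 ∧ U (t + 1) b.1 b.2 ≤ m + 1 := by
      simp only [h.todo _ _ t le_rfl, ht, true_and]
    rw [e1, e2, e3, h.circ]
    have l1 := hU.le i j
    have l2 := hU.eq_iff_adjacent hI (m := m + 1) (i := i) (j := j) (by omega)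
    have l3 := hU.lt_iff_adjacent hI (m := m + 1) (i := i) (j := j) (by omega) (by omega)
    rcases lt_trichotomy (U t i j) (m + 1) with c | c | c
    · omega
    · rw [← l3 c]; omega
    · by_cases c' : U (t + 1) i j ≤ m + 1
      · rw [← l2 c c']; omega
      · omega
  zero i j := by
    rw [Ne, switch_eq_other (by simp) (by simp)]
    exact h.zero i j
  done i j r hr := by
    rcases Nat.lt_succ_iff_lt_or_eq.1 hr with hr | rfl
    · rw [switch_eq_other (by simp; omega) (by simp)]
      exact h.done i j r hr
    · rw [switch_eq_num (by simp)]
      have e1 := h.todo i j r le_rfl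
      have e2 : (∃ b, Adjacent (i, j) b ∧ S b = some .circ) ↔
          ∃ b : Box, Adjacent (i, j) b ∧ U r b.1 b.2 = m + 1 := by simp only [h.circ]
      have e3 : (∃ b, Adjacent (i, j) b ∧ S b = some (.num (r + 1))) ↔
          ∃ b : Box, Adjacent (i, j) b ∧ m + 1 < U r b.1 b.2 ∧ U (r + 1) b.1 b.2 ≤ m + 1 := by
        simp only [h.todo _ _ r le_rfl, ht, true_and]
      rw [e1, e2, e3, h.circ]
      have l1 := hU.le i j
      have l2 := hU.eq_iff_adjacent hI (m := m + 1) (i := i) (j := j) (by omega)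
      have l3 := hU.lt_iff_adjacent hI (m := m + 1) (i := i) (j := j) (by omega) (by omega)
      rcases lt_trichotomy (U r i j) (m + 1) with c | c | c
      · omega
      · rw [← l3 c]; omega
      · by_cases c' : U (r + 1) i j ≤ m + 1
        · rw [← l2 c c']; omega
        · omega
  todo i j r hr := by
    rw [switch_eq_other (by simp; omega) (by simp)]
    exact h.todo i j r (by omega)

theorem IsSlideState.foldl {U : ℕ → ℕ → ℕ → ℕ} {N q m : ℕ} {S : Filling Label}
    (h : IsSlideState U q m 0 S) (hm : m < N)
    (hU : ∀ t < q, SlideStep (N + 1) (U t) (U (t + 1))) (hI : ∀ t ≤ q, IsIncr (N + 1) (U t))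
    {t : ℕ} (ht : t ≤ q) :
    IsSlideState U q m t
      ((List.range' 1 t).foldl (fun S r => ShiftedHecke.switch (.num r) .circ S) S) := by
  induction t with
  | zero => exact h
  | succ t ih =>
    rw [List.range'_1_concat, List.foldl_append, List.foldl_cons, List.foldl_nil, add_comm 1 t]
    exact (ih (by omega)).switch ht hm (hU t ht) (hI t (by omega))

/-- One slide lowers the level by one: `IsSlideState` at time 0 is level m + 1 with the circles put
in, and at time q it is level m once the circles are erased. -/
theorem IsLevel.kjdt {U : ℕ → ℕ → ℕ → ℕ} {N q m : ℕ} {F : Filling ℕ} {C : Set Box}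
    (h : IsLevel U q (m + 1) F) (hm : m < N) (hC : ∀ b : Box, b ∈ C ↔ U 0 b.1 b.2 = m + 1)
    (hU : ∀ t < q, SlideStep (N + 1) (U t) (U (t + 1))) (hI : ∀ t ≤ q, IsIncr (N + 1) (U t)) :
    IsLevel U q m (kjdt 1 q C F) := by
  have hle : ∀ r ≤ q, ∀ i j, U r i j ≤ U 0 i j := by
    intro r hr i j
    induction r with
    | zero => exact le_rfl
    | succ r ih => exact ((hU r hr).le i j).trans (ih (by omega))
  have h0 : IsSlideState U q m 0 (addCirc C F) := by
    refine ⟨?_, ?_, ?_, ?_⟩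
    · intro i j
      unfold addCirc
      rw [← hC (i, j)]
      split_ifs with h1
      · simp [h1]
      · simp [h1]
    · intro i j
      unfold addCirc
      split_ifs with h1
      · simp
      · have := h.zero i j
        simpa using this
    · intro i j r hr
      omega
    · intro i j r _
      unfold addCirc
      split_ifs with h1
      · rw [hC (i, j)] at h1
        simp only [Option.some.injEq, reduceCtorEq, false_iff]
        -- Values only decrease in t, so a box starting at m + 1 never exceeds m + 1 and has no
        -- label at level m + 1.
        rintro ⟨h2, h3, h4⟩
        have := hle r h2.le i j
        simp only at h1
        omega
      · rw [← h.succ]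
        simp
  have h1 := h0.foldl hm hU hI le_rfl
  unfold ShiftedHecke.kjdt
  rw [Nat.add_sub_cancel]
  generalize (List.range' 1 q).foldl _ _ = S at *
  have key : ∀ b n, eraseCirc S b = some n ↔ S b = some (.num n) := by
    intro b n
    unfold eraseCirc
    rcases S b with _ | _ | k <;> simp
  refine ⟨?_, ?_⟩
  · intro i j
    rw [Ne, key]
    exact h1.zero i j
  · intro i j r
    rw [key]
    by_cases hr : r < q
    · exact h1.done i j r hr
    · have := h1.todo i j r (by omega)
      simp only [this, hr, false_and]

theorem IsLevel.foldl_kjdt {U : ℕ → ℕ → ℕ → ℕ} {N q : ℕ} {F : Filling ℕ} {C : ℕ → Set Box}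
    (h : IsLevel U q N F) (hC : ∀ m < N, ∀ b : Box, b ∈ C (m + 1) ↔ U 0 b.1 b.2 = m + 1)
    (hU : ∀ t < q, SlideStep (N + 1) (U t) (U (t + 1))) (hI : ∀ t ≤ q, IsIncr (N + 1) (U t)) :
    IsLevel U q 0 ((List.range' 1 N).reverse.foldl (fun S k => ShiftedHecke.kjdt 1 q (C k) S) F) := by
  have key : ∀ m, m ≤ N → ∀ F, IsLevel U q m F →
      IsLevel U q 0 ((List.range' 1 m).reverse.foldl (fun S k => ShiftedHecke.kjdt 1 q (C k) S) F) := by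
    intro m
    induction m with
    | zero => exact fun _ F hF => hF
    | succ m ih =>
      intro hm F hF
      rw [List.range'_1_concat, List.reverse_append, List.reverse_singleton, List.singleton_append,
        List.foldl_cons, add_comm 1 m]
      exact ih (by omega) _ (hF.kjdt hm (hC m hm) hU hI)
  exact key N le_rfl F h

/-! ### Increasing shifted tableaux through neighbouring boxes and row ends -/

/-- The increasing shifted tableaux, described by conditions on neighbouring boxes. -/
structure IsLocal (T : Filling ℕ) : Prop where
  le {i j v : ℕ} (h : T (i, j) = some v) : i ≤ j
  pos {i j v : ℕ} (h : T (i, j) = some v) : 0 < v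
  left {i j v : ℕ} (h : T (i, j + 1) = some v) (hij : i ≤ j) : ∃ u < v, T (i, j) = some u
  up {i j v : ℕ} (h : T (i + 1, j) = some v) : ∃ u < v, T (i, j) = some u
  bounded : ∃ M, ∀ i j v, T (i, j) = some v → j < M

theorem IsLocal.left_lt {T : Filling ℕ} (hT : IsLocal T) {i j j' v : ℕ} (h : T (i, j') = some v)
    (hij : i ≤ j) (hj : j < j') : ∃ u < v, T (i, j) = some u := by
  induction j', hj using Nat.le_induction generalizing v with
  | base => exact hT.left h hij
  | succ k hk ih =>
    obtain ⟨u, hu, h'⟩ := hT.left h (by omega)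
    obtain ⟨w, hw, h''⟩ := ih h'
    exact ⟨w, hw.trans hu, h''⟩

theorem IsLocal.up_lt {T : Filling ℕ} (hT : IsLocal T) {i i' j v : ℕ} (h : T (i', j) = some v)
    (hi : i < i') : ∃ u < v, T (i, j) = some u := by
  induction i', hi using Nat.le_induction generalizing v with
  | base => exact hT.up h
  | succ k hk ih =>
    obtain ⟨u, hu, h'⟩ := hT.up h
    obtain ⟨w, hw, h''⟩ := ih h'
    exact ⟨w, hw.trans hu, h''⟩

theorem exists_rowEnd {D : ℕ → ℕ → Prop} (hle : ∀ i j, D i j → i ≤ j)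
    (hleft : ∀ i j, D i (j + 1) → i ≤ j → D i j) {M : ℕ} (hM : ∀ i j, D i j → j < M) :
    ∃ a : ℕ → ℕ, ∀ i, i ≤ a i ∧ ∀ j, D i j ↔ i ≤ j ∧ j < a i := by
  classical
  suffices h : ∀ i, ∃ e, i ≤ e ∧ ∀ j, D i j ↔ i ≤ j ∧ j < e by
    choose a ha using h
    exact ⟨a, ha⟩
  intro i
  have hex : ∃ j, i ≤ j ∧ ¬ D i j := ⟨max i M, le_max_left _ _, fun h => by
    have := hM i _ h
    omega⟩
  refine ⟨Nat.find hex, (Nat.find_spec hex).1, fun j => ⟨fun h => ⟨hle i j h, ?_⟩, fun h => ?_⟩⟩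
  · by_contra hc
    push Not at hc
    suffices h' : ∀ k, Nat.find hex ≤ k → ¬ D i k from h' j hc h
    intro k hk
    induction k, hk using Nat.le_induction with
    | base => exact (Nat.find_spec hex).2
    | succ k hk ih => exact fun h' => ih (hleft i k h' ((Nat.find_spec hex).1.trans hk))
  · have := Nat.find_min hex h.2
    tauto

/-- The boxes of `T` with labels at most `r` form the shape with row ends `a`. -/
structure HasEnds (T : Filling ℕ) (r : ℕ) (a : ℕ → ℕ) : Prop where
  shape : IsShape a
  iff (i j : ℕ) : (∃ v ≤ r, T (i, j) = some v) ↔ i ≤ j ∧ j < a i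

theorem IsLocal.exists_hasEnds {T : Filling ℕ} (hT : IsLocal T) (r : ℕ) : ∃ a, HasEnds T r a := by
  obtain ⟨M, hM⟩ := hT.bounded
  obtain ⟨a, ha⟩ := exists_rowEnd (D := fun i j => ∃ v ≤ r, T (i, j) = some v)
    (fun i j ⟨v, _, h⟩ => hT.le h)
    (fun i j ⟨v, hv, h⟩ hij => by
      obtain ⟨u, hu, h'⟩ := hT.left h hij
      exact ⟨u, hu.le.trans hv, h'⟩)
    (fun i j ⟨v, _, h⟩ => hM i j v h)
  refine ⟨a, ⟨fun i => (ha i).1, fun i => ?_⟩, fun i => (ha i).2⟩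
  by_contra! hc
  obtain ⟨v, hv, h⟩ := ((ha (i + 1)).2 (a (i + 1) - 1)).2 (by omega)
  obtain ⟨u, hu, h'⟩ := hT.up h
  have := ((ha i).2 (a (i + 1) - 1)).1 ⟨u, hu.le.trans hv, h'⟩
  omega

theorem HasEnds.eq_succ_iff {T : Filling ℕ} {r : ℕ} {a b : ℕ → ℕ} (ha : HasEnds T r a)
    (hb : HasEnds T (r + 1) b) (i j : ℕ) :
    T (i, j) = some (r + 1) ↔ i ≤ j ∧ a i ≤ j ∧ j < b i := by
  have h1 := ha.iff i j
  have h2 := hb.iff i j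
  constructor
  · intro h
    have := h2.1 ⟨_, le_rfl, h⟩
    refine ⟨this.1, ?_, this.2⟩
    by_contra! hc
    obtain ⟨v, hv, h'⟩ := h1.2 ⟨this.1, hc⟩
    rw [h, Option.some.injEq] at h'
    omega
  · rintro ⟨h3, h4, h5⟩
    obtain ⟨v, hv, h⟩ := h2.2 ⟨h3, h5⟩
    rcases hv.lt_or_eq with h6 | rfl
    · have := h1.1 ⟨v, by omega, h⟩
      omega
    · exact h

/-- The label r + 1 occurs at most once in each row, and the box above an occurrence has a smaller
label. -/
theorem HasEnds.rookStrip {T : Filling ℕ} (hT : IsLocal T) {r : ℕ} {a b : ℕ → ℕ}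
    (ha : HasEnds T r a) (hb : HasEnds T (r + 1) b) : RookStrip a b where
  le i := by
    by_contra! hc
    have := hb.shape.le i
    obtain ⟨v, hv, h⟩ := (ha.iff i (b i)).2 (by omega)
    have := (hb.iff i (b i)).1 ⟨v, by omega, h⟩
    omega
  le_succ i := by
    by_contra! hc
    have h0 := ha.shape.le i
    have h1 := (ha.eq_succ_iff hb i (a i + 1)).2 (by omega)
    obtain ⟨u, hu, h⟩ := hT.left h1 (by omega)
    have := (ha.iff i (a i)).1 ⟨u, by omega, h⟩
    omega
  succ i := by
    by_contra! hc
    have h0 := ha.shape.le (i + 1)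
    have h1 := (ha.eq_succ_iff hb (i + 1) (b (i + 1) - 1)).2 (by omega)
    obtain ⟨u, hu, h⟩ := hT.up h1
    have := (ha.iff i (b (i + 1) - 1)).1 ⟨u, by omega, h⟩
    omega

theorem IsStrictPartition.getD_succ {l : List ℕ} (hl : IsStrictPartition l) (i : ℕ) :
    l.getD (i + 1) 0 < l.getD i 0 ∨ l.getD (i + 1) 0 = 0 := by
  by_cases h : i + 1 < l.length
  · left
    have := List.pairwise_iff_getElem.1 hl.1 i (i + 1) (by omega) h (by omega)
    simpa [List.getD, h, show i < l.length by omega] using this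
  · right
    simp [List.getD, h]

theorem IsIncreasingTableau.isLocal {T : Filling ℕ} (hT : IsIncreasingTableau T) : IsLocal T := by
  obtain ⟨l, hl, hsome, hpos, hinc⟩ := hT
  have mem : ∀ {i j v}, T (i, j) = some v → i ≤ j ∧ j < i + l.getD i 0 := fun {i j v} h =>
    (hsome (i, j)).1 (by rw [h]; rfl)
  have ex : ∀ {i j}, i ≤ j → j < i + l.getD i 0 → ∃ u, T (i, j) = some u := fun {i j} h1 h2 =>
    Option.isSome_iff_exists.1 ((hsome (i, j)).2 ⟨h1, h2⟩)
  refine ⟨fun h => (mem h).1, fun h => hpos _ _ h, ?_, ?_, l.length + l.sum, ?_⟩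
  · intro i j v h hij
    have := mem h
    obtain ⟨u, hu⟩ := ex hij (by omega)
    exact ⟨u, hinc.1 _ _ _ _ _ (by omega) hu h, hu⟩
  · intro i j v h
    have h1 := mem h
    have := hl.getD_succ i
    obtain ⟨u, hu⟩ := ex (show i ≤ j by omega) (by omega)
    exact ⟨u, hinc.2 _ _ _ _ _ (by omega) hu h, hu⟩
  · intro i j v h
    have h1 := mem h
    by_cases hi : i < l.length
    · have h2 : l.getD i 0 = l[i] := by simp [List.getD, hi]
      have h3 : l[i] ≤ l.sum := List.single_le_sum (by simp) _ (List.getElem_mem hi)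
      omega
    · have h2 : l.getD i 0 = 0 := by simp [List.getD, hi]
      omega

theorem IsLocal.isIncreasingTableau {T : Filling ℕ} (hT : IsLocal T) : IsIncreasingTableau T := by
  obtain ⟨M, hM⟩ := hT.bounded
  obtain ⟨a, ha⟩ := exists_rowEnd (D := fun i j => ∃ v, T (i, j) = some v)
    (fun i j ⟨v, h⟩ => hT.le h) (fun i j ⟨v, h⟩ hij => ⟨_, (hT.left h hij).choose_spec.2⟩)
    (fun i j ⟨v, h⟩ => hM i j v h)
  have hs : IsShape a := by
    refine ⟨fun i => (ha i).1, fun i => ?_⟩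
    by_contra! hc
    obtain ⟨v, h⟩ := ((ha (i + 1)).2 (a (i + 1) - 1)).2 (by omega)
    obtain ⟨u, hu, h'⟩ := hT.up h
    have := ((ha i).2 (a (i + 1) - 1)).1 ⟨u, h'⟩
    omega
  have hex : ∃ k, a k = k := by
    -- Boxes satisfy row ≤ column < M, so row M is empty.
    refine ⟨M, ?_⟩
    by_contra hc
    have := hs.le M
    obtain ⟨v, h⟩ := ((ha M).2 M).2 (by omega)
    have := hM _ _ _ h
    omega
  classical
  have hk := Nat.find_spec hex
  have hmin : ∀ i < Nat.find hex, i < a i := fun i hi =>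
    lt_of_le_of_ne (hs.le i) (Ne.symm (Nat.find_min hex hi))
  generalize Nat.find hex = k at hk hmin
  have hge : ∀ i, k ≤ i → a i = i := fun i hi => by
    have := hs.anti hi
    have := hs.le i
    omega
  have hget : ∀ i, ((List.range k).map fun i => a i - i).getD i 0 = a i - i := by
    intro i
    by_cases h : i < k
    · simp [List.getD, h]
    · have := hge i (by omega)
      simp [List.getD, h]
      omega
  refine ⟨(List.range k).map fun i => a i - i, ⟨?_, ?_⟩, ?_, fun b x h => hT.pos (i := b.1) (j := b.2) h,
    ?_, ?_⟩
  · rw [List.pairwise_map]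
    refine List.Pairwise.imp_of_mem ?_ (List.pairwise_lt_range (n := k))
    intro i j hi hj hij
    rw [List.mem_range] at hi hj
    have := hmin i hi
    have := hmin j hj
    have := hs.anti hij.le
    omega
  · simp only [List.mem_map, List.mem_range]
    rintro _ ⟨i, hi, rfl⟩
    have := hmin i hi
    omega
  · rintro ⟨i, j⟩
    have h1 := (ha i).2 j
    have h2 := hs.le i
    simp only [shiftedShape, Set.mem_ofPred_eq, hget, Option.isSome_iff_exists, h1]
    omega
  · intro i j j' x y hj hx hy
    obtain ⟨u, hu, h⟩ := hT.left_lt hy (hT.le hx) hj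
    rw [hx, Option.some.injEq] at h
    omega
  · intro i i' j x y hi hx hy
    obtain ⟨u, hu, h⟩ := hT.up_lt hy hi
    rw [hx, Option.some.injEq] at h
    omega

theorem isIncreasingTableau_iff {T : Filling ℕ} : IsIncreasingTableau T ↔ IsLocal T :=
  ⟨fun h => h.isLocal, fun h => h.isIncreasingTableau⟩

/-- The neighbours of `(i, j)` to the left and above, as far as they belong to the shifted quarter
plane, have labels less than `y`. -/
def Valid (T : Filling ℕ) (y i j : ℕ) : Prop :=
  (∀ j', j = j' + 1 → i ≤ j' → ∃ u < y, T (i, j') = some u) ∧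
  ∀ i', i = i' + 1 → ∃ u < y, T (i', j) = some u

theorem Filling.set_apply {α : Type} (T : Filling α) (b c : Box) (x : α) [Decidable (c = b)] :
    T.set b x c = if c = b then some x else T c := by
  unfold Filling.set
  by_cases h : c = b
  · subst h; simp
  · simp [h]

/-- Lowering a label cannot disturb the boxes to the right and below, and next to an absent box
these are absent too. Only the left and upper neighbours impose a condition. -/
theorem IsLocal.set_iff {T : Filling ℕ} (hT : IsLocal T) {y i j : ℕ} (hij : i ≤ j) (hy : 0 < y)
    (hlt : ∀ v, T (i, j) = some v → y < v) : IsLocal (T.set (i, j) y) ↔ Valid T y i j := by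
  constructor
  · intro h
    have hself : T.set (i, j) y (i, j) = some y := by simp [Filling.set_apply]
    constructor
    · rintro j' rfl hij'
      obtain ⟨u, hu, h'⟩ := h.left hself hij'
      rw [Filling.set_apply, if_neg (by simp)] at h'
      exact ⟨u, hu, h'⟩
    · rintro i' rfl
      obtain ⟨u, hu, h'⟩ := h.up hself
      rw [Filling.set_apply, if_neg (by simp)] at h'
      exact ⟨u, hu, h'⟩
  · rintro ⟨h1, h2⟩
    refine ⟨?_, ?_, ?_, ?_, ?_⟩
    · intro i' j' v h
      rw [Filling.set_apply] at h
      split_ifs at h with h3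
      · simp only [Prod.mk.injEq] at h3; omega
      · exact hT.le h
    · intro i' j' v h
      rw [Filling.set_apply] at h
      split_ifs at h with h3
      · simp only [Option.some.injEq] at h; omega
      · exact hT.pos h
    · intro i' j' v h hij'
      rw [Filling.set_apply] at h
      split_ifs at h with h3
      · simp only [Prod.mk.injEq, Option.some.injEq] at h3 h
        obtain ⟨rfl, rfl⟩ := h3
        subst h
        obtain ⟨u, hu, h'⟩ := h1 j' rfl hij'
        refine ⟨u, hu, ?_⟩
        rw [Filling.set_apply, if_neg (by simp), h']
      · obtain ⟨u, hu, h'⟩ := hT.left h hij'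
        rw [Filling.set_apply]
        split_ifs with h4
        · have := hlt u (h4 ▸ h')
          exact ⟨y, by omega, rfl⟩
        · exact ⟨u, hu, h'⟩
    · intro i' j' v h
      rw [Filling.set_apply] at h
      split_ifs at h with h3
      · simp only [Prod.mk.injEq, Option.some.injEq] at h3 h
        obtain ⟨rfl, rfl⟩ := h3
        subst h
        obtain ⟨u, hu, h'⟩ := h2 i' rfl
        refine ⟨u, hu, ?_⟩
        rw [Filling.set_apply, if_neg (by simp), h']
      · obtain ⟨u, hu, h'⟩ := hT.up h
        rw [Filling.set_apply]
        split_ifs with h4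
        · have := hlt u (h4 ▸ h')
          exact ⟨y, by omega, rfl⟩
        · exact ⟨u, hu, h'⟩
    · obtain ⟨M, hM⟩ := hT.bounded
      refine ⟨max M (j + 1), fun i' j' v h => ?_⟩
      rw [Filling.set_apply] at h
      split_ifs at h with h3
      · simp only [Prod.mk.injEq] at h3; omega
      · have := hM _ _ _ h
        omega

/-! ### Insertion followed by the size of the labels -/

/-- The situation of an insertion into a tableau `T` before the letter `y` is inserted into the
line `L`, from the point of view of the labels at most `r`: the current tableau `S` differs from
`T` only in labels at most `r`, and the letter `y` will pass no label of `L` that is at most `r`. -/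
structure InsState (T : Filling ℕ) (a : ℕ → ℕ) (r : ℕ) (L : Line) (y : ℕ) (S : Filling ℕ) :
    Prop where
  isLocal : IsLocal S
  high (b : Box) (v : ℕ) (h : r < v) : S b = some v ↔ T b = some v
  ends : HasEnds S r a
  pos : 0 < y
  le : y ≤ r
  line (b : Box) (v : ℕ) (hb : L.Contains b) (h : S b = some v) (hv : v ≤ r) : v ≤ y
  row (p : ℕ) (h : L = .row p) (i : ℕ) (hi : i < p) : p + 1 ≤ a i
  col (s : ℕ) (h : L = .col s) : (∃ j u, s = j + 1 ∧ u < y ∧ S (0, j) = some u) ∧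
    ∀ i, s ≤ i → a i = i

open Classical in
/-- Row ends of the labels at most `r`, after `y` has taken its place in the line `L`. -/
noncomputable def curEnd (a : ℕ → ℕ) (L : Line) (y : ℕ) (S : Filling ℕ) (i : ℕ) : ℕ :=
  if L.Contains (i, a i) ∧ Valid S y i (a i) then a i + 1 else a i

open Classical in
/-- The filling `S` after `y` has taken its place in the line `L`. -/
noncomputable def cur (a : ℕ → ℕ) (L : Line) (y : ℕ) (S : Filling ℕ) : Filling ℕ := fun b =>
  if b.2 = a b.1 ∧ L.Contains b ∧ Valid S y b.1 b.2 then some y else S b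

/-- The place of the letter inserted into the line `L`: the first box of the line outside the shape
with row ends `a`. -/
def IsFirst (a : ℕ → ℕ) (L : Line) (e : Box) : Prop :=
  L.Contains e ∧ e.1 ≤ e.2 ∧ a e.1 ≤ e.2 ∧
    match L with
    | .row _ => e.2 ≤ a e.1
    | .col _ => ∀ i < e.1, e.2 < a i

def lineLabel (N : ℕ) (a K : ℕ → ℕ) : Line → ℕ → ℕ → ℕ
  | .row p => rowLabel N a K p
  | .col s => colLabel N a K s

section

variable {T S : Filling ℕ} {a b : ℕ → ℕ} {r y : ℕ} {L : Line}

theorem Valid.left_lt (h : HasEnds S r a) (hy : y ≤ r) {i j : ℕ} (hv : Valid S y i j) (hij : i < j) :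
    j ≤ a i := by
  obtain ⟨j, rfl⟩ : ∃ j', j = j' + 1 := ⟨j - 1, by omega⟩
  obtain ⟨u, hu, h'⟩ := hv.1 j rfl (by omega)
  have := (h.iff i j).1 ⟨u, by omega, h'⟩
  omega

theorem Valid.up_lt (h : HasEnds S r a) (hy : y ≤ r) {i j : ℕ} (hv : Valid S y (i + 1) j) :
    j < a i := by
  obtain ⟨u, hu, h'⟩ := hv.2 i rfl
  exact ((h.iff i j).1 ⟨u, by omega, h'⟩).2

/-- Where y fits, the neighbours to the left and above have labels less than y ≤ r and so lie in the
shape a; this leaves only the first box of the line outside a. -/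
theorem IsFirst.eq_of_valid {e : Box} (he : IsFirst a L e) (h : HasEnds S r a) (hy : y ≤ r)
    {i : ℕ} (hL : L.Contains (i, a i)) (hv : Valid S y i (a i)) : (i, a i) = e := by
  obtain ⟨e1, e2⟩ := e
  have h3 := h.shape.le i
  rcases L with p | s
  · obtain ⟨h0, -, h1, h2⟩ := he
    simp only [Line.Contains] at h0 hL h1 h2
    subst h0 hL
    simp only [Prod.mk.injEq, true_and]
    omega
  · obtain ⟨h0, h0', h1, h2⟩ := he
    simp only [Line.Contains] at h0 hL h1 h2 h0'
    rcases lt_trichotomy i e1 with hi | rfl | hi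
    · have := h2 i hi
      omega
    · rw [hL, h0]
    · obtain ⟨i, rfl⟩ : ∃ i', i = i' + 1 := ⟨i - 1, by omega⟩
      have := hv.up_lt h hy
      have := h.shape.anti (show e1 ≤ i by omega)
      omega

theorem IsFirst.eq_end {e : Box} (he : IsFirst a L e) (h : HasEnds S r a) (hy : y ≤ r)
    (hv : Valid S y e.1 e.2) : e.2 = a e.1 := by
  obtain ⟨e1, e2⟩ := e
  obtain ⟨h0, h1, h2, -⟩ := he
  simp only at *
  have := h.shape.le e1
  by_cases h3 : e1 < e2
  · have := hv.left_lt h hy h3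
    omega
  · omega

open Classical in
-- Links the description by row ends with the insertion rules: whether y is placed is exactly the
-- test in those rules, applied to the box e.
theorem InsState.cur_eq (h : InsState T a r L y S) {e : Box} (he : IsFirst a L e) :
    cur a L y S = if IsIncreasingTableau (S.set e y) then S.set e y else S := by
  have hiff : IsIncreasingTableau (S.set e y) ↔ Valid S y e.1 e.2 := by
    rw [isIncreasingTableau_iff]
    refine h.isLocal.set_iff he.2.1 h.pos fun v hv => ?_
    by_contra hc
    have := (h.ends.iff e.1 e.2).1 ⟨v, by have := h.le; omega, hv⟩
    have := he.2.2.1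
    omega
  simp only [hiff]
  funext b
  unfold cur
  by_cases hb : b.2 = a b.1 ∧ L.Contains b ∧ Valid S y b.1 b.2
  · have hb' : b = e := by
      obtain ⟨h1, h2, h3⟩ := hb
      obtain ⟨b1, b2⟩ := b
      simp only at h1
      subst h1
      exact he.eq_of_valid h.ends h.le h2 h3
    subst hb'
    rw [if_pos hb, if_pos hb.2.2, Filling.set_apply, if_pos rfl]
  · rw [if_neg hb]
    split_ifs with hv
    · rw [Filling.set_apply, if_neg]
      rintro rfl
      exact hb ⟨he.eq_end h.ends h.le hv, he.1, hv⟩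
    · rfl

theorem InsState.isLocal_cur (h : InsState T a r L y S) {e : Box} (he : IsFirst a L e) :
    IsLocal (cur a L y S) := by
  rw [h.cur_eq he]
  split_ifs with h1
  · exact h1.isLocal
  · exact h.isLocal

theorem le_curEnd (a : ℕ → ℕ) (L : Line) (y : ℕ) (S : Filling ℕ) (i : ℕ) :
    a i ≤ curEnd a L y S i := by
  unfold curEnd
  split_ifs <;> omega

theorem curEnd_le (a : ℕ → ℕ) (L : Line) (y : ℕ) (S : Filling ℕ) (i : ℕ) :
    curEnd a L y S i ≤ a i + 1 := by
  unfold curEnd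
  split_ifs <;> omega

theorem curEnd_eq_succ_iff (a : ℕ → ℕ) (L : Line) (y : ℕ) (S : Filling ℕ) (i : ℕ) :
    curEnd a L y S i = a i + 1 ↔ L.Contains (i, a i) ∧ Valid S y i (a i) := by
  unfold curEnd
  split_ifs with h
  · simpa using h
  · simpa using h

theorem InsState.cur_iff (h : InsState T a r L y S) (i j : ℕ) :
    (∃ u ≤ r, cur a L y S (i, j) = some u) ↔ i ≤ j ∧ j < curEnd a L y S i := by
  have h1 := h.ends.iff i j
  have h2 := h.ends.shape.le i
  unfold cur curEnd
  by_cases hj : j = a i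
  · subst hj
    by_cases hc : L.Contains (i, a i) ∧ Valid S y i (a i)
    · rw [if_pos ⟨rfl, hc⟩, if_pos hc]
      exact iff_of_true ⟨y, h.le, rfl⟩ (by omega)
    · rw [if_neg fun h' => hc h'.2, if_neg hc]
      exact h1
  · rw [if_neg (by tauto), h1]
    split_ifs <;> omega

theorem InsState.rowState {p : ℕ} (h : InsState T a r (.row p) y S) :
    RowState a (curEnd a (.row p) y S) p where
  eq i hi := by
    unfold curEnd
    rw [if_neg]
    rintro ⟨h1, -⟩
    exact hi h1
  le := le_curEnd ..
  le_succ := curEnd_le ..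
  up i hi := by
    subst hi
    have h1 := h.row _ rfl i (by omega)
    have h2 := h.ends.shape.succ i
    have h3 := curEnd_eq_succ_iff a (.row (i + 1)) y S (i + 1)
    have h4 := curEnd_le a (.row (i + 1)) y S (i + 1)
    by_cases hc : curEnd a (.row (i + 1)) y S (i + 1) = a (i + 1) + 1
    · have := (h3.1 hc).2.up_lt h.ends h.le
      omega
    · omega
  nondiag i hi := h.row p rfl i hi
  zero := by
    have h1 := le_curEnd a (.row p) y S 0
    by_cases hp : 0 < p
    · have := h.row p rfl 0 hp
      omega
    · obtain rfl : p = 0 := by omega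
      by_cases h0 : a 0 = 0
      · have := (curEnd_eq_succ_iff a (.row 0) y S 0).2 ⟨rfl, by
          rw [h0]
          exact ⟨fun j hj => by omega, fun j hj => by omega⟩⟩
        omega
      · omega

theorem InsState.colState {s : ℕ} (h : InsState T a r (.col s) y S) :
    ColState a (curEnd a (.col s) y S) s where
  pos := by
    obtain ⟨⟨j, u, h1, -⟩, -⟩ := h.col s rfl
    omega
  diag := (h.col s rfl).2
  eq i := by
    have h1 := le_curEnd a (.col s) y S i
    have h2 := curEnd_le a (.col s) y S i
    have h3 := (curEnd_eq_succ_iff a (.col s) y S i).1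
    by_cases hc : curEnd a (.col s) y S i = a i + 1
    · have : a i = s := (h3 hc).1
      omega
    · omega
  up i := by
    have h1 := le_curEnd a (.col s) y S (i + 1)
    have h2 := curEnd_le a (.col s) y S (i + 1)
    have h3 := (curEnd_eq_succ_iff a (.col s) y S (i + 1)).1
    by_cases hc : curEnd a (.col s) y S (i + 1) = a (i + 1) + 1
    · have h4 := (h3 hc).2.up_lt h.ends h.le
      have : a (i + 1) = s := (h3 hc).1
      omega
    · omega
  zero := by
    obtain ⟨⟨j, u, rfl, hu, h0⟩, -⟩ := h.col s rfl
    have := h.le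
    have h1 := (h.ends.iff 0 j).1 ⟨u, by omega, h0⟩
    have h2 := le_curEnd a (.col (j + 1)) y S 0
    by_cases h3 : a 0 = j + 1
    · have := (curEnd_eq_succ_iff a (.col (j + 1)) y S 0).2 ⟨h3, by
        rw [h3]
        refine ⟨fun j' hj _ => ?_, fun i' hi => by omega⟩
        obtain rfl : j = j' := by omega
        exact ⟨u, hu, h0⟩⟩
      omega
    · omega

theorem InsState.iff_succ (h : InsState T a r L y S) (ha : HasEnds T r a)
    (hb : HasEnds T (r + 1) b) (i j : ℕ) :
    (∃ v ≤ r + 1, S (i, j) = some v) ↔ i ≤ j ∧ j < b i := by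
  rw [← hb.iff]
  have h1 := (h.ends.iff i j).trans (ha.iff i j).symm
  constructor
  · rintro ⟨v, hv, hS⟩
    rcases hv.lt_or_eq with h2 | rfl
    · obtain ⟨u, hu, hu'⟩ := h1.1 ⟨v, by omega, hS⟩
      exact ⟨u, by omega, hu'⟩
    · exact ⟨_, le_rfl, (h.high _ _ (by omega)).1 hS⟩
  · rintro ⟨v, hv, hS⟩
    rcases hv.lt_or_eq with h2 | rfl
    · obtain ⟨u, hu, hu'⟩ := h1.2 ⟨v, by omega, hS⟩
      exact ⟨u, by omega, hu'⟩
    · exact ⟨_, le_rfl, (h.high _ _ (by omega)).2 hS⟩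

/-- If no label `r + 1` is met on the line, the situation remains the same. -/
theorem InsState.stay (h : InsState T a r L y S) (hT : IsLocal T) (ha : HasEnds T r a)
    (hb : HasEnds T (r + 1) b) (hL : ∀ e, L.Contains e → T e ≠ some (r + 1)) :
    InsState T b (r + 1) L y S where
  isLocal := h.isLocal
  high e v hv := h.high e v (by omega)
  ends := ⟨hb.shape, h.iff_succ ha hb⟩
  pos := h.pos
  le := by have := h.le; omega
  line e v he hS hv := by
    rcases hv.lt_or_eq with h2 | rfl
    · exact h.line e v he hS (by omega)
    · exact absurd ((h.high _ _ (by omega)).1 hS) (hL e he)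
  row p hp i hi := (h.row p hp i hi).trans ((ha.rookStrip hT hb).le i)
  col s hs := by
    refine ⟨(h.col s hs).1, fun i hi => ?_⟩
    have h1 := (h.col s hs).2
    have h2 := ha.rookStrip hT hb
    have := h1 i hi
    have := hb.shape.le i
    -- A new box in row s would be (s, s), which lies on the line; in a later row it would need an
    -- old box above it, in a row that is empty.
    by_contra hc
    by_cases his : i = s
    · subst his hs
      exact hL (i, i) rfl ((ha.eq_succ_iff hb i i).2 (by omega))
    · obtain ⟨i, rfl⟩ : ∃ i', i = i' + 1 := ⟨i - 1, by omega⟩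
      have := h1 i (by omega)
      have := h2.succ i
      omega

theorem InsState.cur_stay (h : InsState T a r L y S) (hT : IsLocal T) (ha : HasEnds T r a)
    (hb : HasEnds T (r + 1) b) (hL : ∀ e, L.Contains e → T e ≠ some (r + 1)) {i j : ℕ}
    (hc : L.Contains (i, j)) (hv : Valid S y i j) : j = b i ↔ j = a i := by
  have h1 := ha.shape.le i
  have h2 := ha.rookStrip hT hb
  have h3 := h2.le i
  have h4 := h2.le_succ i
  constructor
  · rintro rfl
    by_contra hne
    have := hv.left_lt h.ends h.le (show i < b i by omega)
    omega
  · rintro rfl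
    by_contra hne
    exact hL _ hc ((ha.eq_succ_iff hb i (a i)).2 (by omega))

theorem InsState.cur_eq_stay (h : InsState T a r L y S) (hT : IsLocal T) (ha : HasEnds T r a)
    (hb : HasEnds T (r + 1) b) (hL : ∀ e, L.Contains e → T e ≠ some (r + 1)) :
    cur b L y S = cur a L y S := by
  funext ⟨i, j⟩
  have key : (j = b i ∧ L.Contains (i, j) ∧ Valid S y i j) ↔
      (j = a i ∧ L.Contains (i, j) ∧ Valid S y i j) :=
    and_congr_left fun h' => h.cur_stay hT ha hb hL h'.1 h'.2
  unfold cur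
  classical exact if_congr key rfl rfl

/-- On the line the place of y does not move; the maximum accounts for rows that acquire r + 1 off
the line. -/
theorem InsState.curEnd_stay (h : InsState T a r L y S) (hT : IsLocal T) (ha : HasEnds T r a)
    (hb : HasEnds T (r + 1) b) (hL : ∀ e, L.Contains e → T e ≠ some (r + 1)) (i : ℕ) :
    curEnd b L y S i = max (curEnd a L y S i) (b i) := by
  have h2 := ha.rookStrip hT hb
  have h3 := h2.le i
  have h4 := h2.le_succ i
  unfold curEnd
  split_ifs with h5 h6 h6
  · have := (h.cur_stay hT ha hb hL h5.1 h5.2).1 rfl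
    omega
  · have := (h.cur_stay hT ha hb hL h5.1 h5.2).1 rfl
    rw [this] at h5
    exact absurd h5 h6
  · have := (h.cur_stay hT ha hb hL h6.1 h6.2).2 rfl
    rw [this] at h6
    exact absurd h6 h5
  · omega

end

section

variable {T S P : Filling ℕ} {a b : ℕ → ℕ} {r y : ℕ} {L : Line}

theorem InsState.exists_isFirst (h : InsState T a r L y S) : ∃ e, IsFirst a L e := by
  classical
  rcases L with p | s
  · exact ⟨(p, a p), rfl, h.ends.shape.le p, le_rfl, le_rfl⟩
  · have hs : a s ≤ s := ((h.col s rfl).2 s le_rfl).le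
    have hex : ∃ i, a i ≤ s := ⟨s, hs⟩
    refine ⟨(Nat.find hex, s), rfl, Nat.find_min' hex hs, Nat.find_spec hex, fun i hi => ?_⟩
    have := Nat.find_min hex hi
    simp only
    omega

theorem isFirst_of_eq (hT : IsLocal T) (ha : HasEnds T r a) (hb : HasEnds T (r + 1) b) {f : Box}
    (hf : L.Contains f) (hTf : T f = some (r + 1)) : IsFirst a L f := by
  obtain ⟨f1, f2⟩ := f
  have h1 := (ha.eq_succ_iff hb f1 f2).1 hTf
  have h2 := (ha.rookStrip hT hb).le_succ f1
  refine ⟨hf, h1.1, h1.2.1, ?_⟩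
  rcases L with p | s
  · simp only
    omega
  · intro i hi
    obtain ⟨u, hu, h3⟩ := hT.up_lt hTf hi
    exact ((ha.iff i f2).1 ⟨u, by omega, h3⟩).2

/-- With no label above r left, y is weakly larger than the whole line, so rule (1) or (2) applies.
-/
theorem InsState.insertsTo_last (h : InsState T a r L y S) (hr : ∀ e v, S e = some v → v ≤ r) :
    InsertsTo L S y (cur a L y S) := by
  obtain ⟨e, he⟩ := h.exists_isFirst
  have h1 : L.AllLE S y := fun b v hb hv => h.line b v hb hv (hr b v hv)
  have h2 : L.IsEnd S e := by
    obtain ⟨e1, e2⟩ := e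
    have h3 : S (e1, e2) = none := by
      rw [Option.eq_none_iff_forall_ne_some]
      intro v hv
      have := ((h.ends.iff e1 e2).1 ⟨v, hr _ _ hv, hv⟩).2
      have := he.2.2.1
      simp only at this
      omega
    have h4 : ∀ i j, i ≤ j → j < a i → S (i, j) ≠ none := by
      intro i j h5 h6 h7
      obtain ⟨v, _, h8⟩ := (h.ends.iff i j).2 ⟨h5, h6⟩
      rw [h7] at h8
      cases h8
    obtain ⟨h5, h6, h7, h8⟩ := he
    rcases L with p | s
    · simp only [Line.Contains] at h5 h6 h7 h8
      subst h5
      exact ⟨rfl, h6, h3, fun j hj hj' => h4 _ _ hj (by simp only at hj'; omega)⟩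
    · simp only [Line.Contains] at h5 h6 h7 h8
      subst h5
      exact ⟨rfl, h3, fun i hi => h4 _ _ (by simp only at hi; omega) (h8 i hi)⟩
  rw [h.cur_eq he]
  split_ifs with hi
  · exact .adjoin h1 h2 hi
  · exact .stay h1 h2 hi

/-- The labels of the line up to r are at most y, so r + 1 is the smallest one above y, and rule (3)
or (4) bumps it. -/
theorem InsState.insertsTo_move (h : InsState T a r L y S) (hT : IsLocal T) (ha : HasEnds T r a)
    (hb : HasEnds T (r + 1) b) {f : Box} (hf : L.Contains f) (hTf : T f = some (r + 1))
    (hP : InsertsTo (L.next f) (cur a L y S) (r + 1) P) : InsertsTo L S y P := by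
  have he := isFirst_of_eq hT ha hb hf hTf
  have h1 : L.IsBumped S y f (r + 1) := by
    refine ⟨hf, (h.high f _ (by omega)).2 hTf, by have := h.le; omega, fun c z hc hz hyz => ?_⟩
    by_contra hlt
    have := h.line c z hc hz (by omega)
    omega
  rw [h.cur_eq he] at hP
  split_ifs at hP with hi
  · exact .replace h1 hi hP
  · exact .bump h1 hi hP

theorem InsState.cur_cases (h : InsState T a r L y S) (e : Box) :
    cur a L y S e = S e ∨ (cur a L y S e = some y ∧ ∀ v, S e = some v → r < v) := by
  unfold cur
  split_ifs with h1
  · refine Or.inr ⟨rfl, fun v hv => ?_⟩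
    by_contra hc
    have := ((h.ends.iff e.1 e.2).1 ⟨v, by omega, hv⟩).2
    omega
  · exact Or.inl rfl

/-- The box f holds either y or still r + 1. In both cases its label is at most r + 1, so the boxes
with labels at most r + 1 are those of T. -/
theorem InsState.move (h : InsState T a r L y S) (hT : IsLocal T) (ha : HasEnds T r a)
    (hb : HasEnds T (r + 1) b) {f : Box} (hf : L.Contains f) (hTf : T f = some (r + 1)) :
    InsState T b (r + 1) (L.next f) (r + 1) (cur a L y S) := by
  classical
  have he := isFirst_of_eq hT ha hb hf hTf
  have hstrip := ha.rookStrip hT hb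
  have hyr := h.le
  have hSf : S f = some (r + 1) := (h.high f _ (by omega)).2 hTf
  have hcur : ∀ e, e ≠ f → cur a L y S e = S e := by
    intro e hef
    rw [h.cur_eq he]
    split_ifs
    · rw [Filling.set_apply, if_neg hef]
    · rfl
  have hcurf : cur a L y S f = some (r + 1) ∨ cur a L y S f = some y := by
    rw [← hSf]
    have := h.cur_cases f
    tauto
  have hdiag : ∀ k, (∀ i, k ≤ i → a i = i ∨ a i ≤ k) → ∀ i, k + 1 ≤ i → b i = i := by
    intro k hk i hi
    obtain ⟨i, rfl⟩ : ∃ i', i = i' + 1 := ⟨i - 1, by omega⟩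
    have := hb.shape.le (i + 1)
    have := hstrip.succ i
    have := hk i (by omega)
    have := hk (i + 1) (by omega)
    omega
  -- Column insertion needs a label below r + 1 in the first row of the column of f. If f is lower,
  -- the box at the top of its column has one; if f is itself in the first row, y must really have
  -- replaced r + 1.
  have hzero : (f.1 = 0 → cur a L y S f = some y) → ∃ j u, f.2 + 1 = j + 1 ∧ u < r + 1 ∧
      cur a L y S (0, j) = some u := by
    intro h0
    obtain ⟨f1, f2⟩ := f
    refine ⟨f2, ?_⟩
    by_cases hf1 : f1 = 0
    · subst hf1
      exact ⟨y, rfl, by omega, h0 rfl⟩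
    · obtain ⟨u, hu, h1⟩ := h.isLocal.up_lt hSf (show 0 < f1 by omega)
      refine ⟨u, rfl, hu, ?_⟩
      rw [hcur _ (by simp; omega), h1]
  have hcurf' : Valid S y f.1 f.2 → cur a L y S f = some y := by
    intro hv
    unfold cur
    rw [if_pos ⟨he.eq_end h.ends h.le hv, hf, hv⟩]
  -- The condition on the new line is automatic, the new letter being r + 1 itself.
  refine ⟨h.isLocal_cur he, ?_, ⟨hb.shape, ?_⟩, by omega, le_rfl, fun _ _ _ _ hv => hv, ?_, ?_⟩
  · intro e v hv
    by_cases hef : e = f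
    · subst hef
      rw [hTf]
      rcases hcurf with h1 | h1 <;> rw [h1]
      simp only [Option.some.injEq]
      omega
    · rw [hcur e hef, h.high e v (by omega)]
  · intro i j
    rw [← h.iff_succ ha hb i j]
    by_cases hef : (i, j) = f
    · rw [hef]
      refine iff_of_true ?_ ⟨_, le_rfl, hSf⟩
      rcases hcurf with h1 | h1
      · exact ⟨_, le_rfl, h1⟩
      · exact ⟨_, by omega, h1⟩
    · rw [hcur _ hef]
  · intro p hp i hi
    rcases L with p' | s
    · simp only [Line.next] at hp
      split_ifs at hp with hd
      simp only [Line.row.injEq] at hp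
      obtain ⟨f1, f2⟩ := f
      obtain rfl : f1 = p' := hf
      simp only at hd
      subst hp
      have h1 := (ha.eq_succ_iff hb f1 f2).1 hTf
      have h2 := hstrip.le_succ f1
      have h3 := hstrip.le i
      by_cases hif : i = f1
      · subst hif; omega
      · obtain ⟨u, hu, h4⟩ := hT.up_lt hTf (show i < f1 by omega)
        have := (ha.iff i f2).1 ⟨u, by omega, h4⟩
        omega
    · simp [Line.next] at hp
  · intro s hs
    obtain ⟨f1, f2⟩ := f
    rcases L with p | s'
    · simp only [Line.next] at hs
      split_ifs at hs with hd
      simp only [Line.col.injEq] at hs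
      obtain rfl : f1 = p := hf
      subst hs
      subst hd
      have h1 := (ha.eq_succ_iff hb f1 f1).1 hTf
      refine ⟨hzero fun h0 => ?_, hdiag f1 fun i hi => ?_⟩
      · simp only at h0
        subst h0
        exact hcurf' ⟨fun j hj => by omega, fun j hj => by omega⟩
      · have := ha.shape.anti hi
        omega
    · simp only [Line.next, Line.col.injEq] at hs
      obtain rfl : f2 = s' := hf
      subst hs
      obtain ⟨⟨j, u, hj, hu, hSj⟩, h2⟩ := h.col _ rfl
      refine ⟨hzero fun h0 => ?_, hdiag f2 fun i hi => Or.inl (h2 i hi)⟩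
      simp only at h0
      subst h0
      refine hcurf' ⟨fun j' hj' _ => ?_, fun j hj => by simp at hj⟩
      simp only at hj'
      obtain rfl : j = j' := by omega
      exact ⟨u, hu, hSj⟩

/-- The labels below r + 1 after placing y form the shape with row ends `curEnd`, so the next
placement is decided by row ends alone. This supplies the hypotheses `hs` of the transition lemmas.
-/
theorem InsState.valid_cur_iff (h : InsState T a r L y S) {i j : ℕ} (hij : i ≤ j) :
    Valid (cur a L y S) (r + 1) i j ↔ (i < j → j ≤ curEnd a L y S i) ∧
      ∀ i', i = i' + 1 → j < curEnd a L y S i' := by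
  have key : ∀ i j, i ≤ j → ((∃ u < r + 1, cur a L y S (i, j) = some u) ↔ j < curEnd a L y S i) := by
    intro i j hij
    have := h.cur_iff i j
    simp only [Nat.lt_succ_iff, this, hij, true_and]
  unfold Valid
  refine and_congr ⟨fun h1 h2 => ?_, fun h1 j' hj hj' => ?_⟩ (forall_congr' fun i' => ?_)
  · obtain ⟨j, rfl⟩ : ∃ j', j = j' + 1 := ⟨j - 1, by omega⟩
    exact (key i j (by omega)).1 (h1 j rfl (by omega))
  · subst hj
    exact (key i j' hj').2 (h1 (by omega))
  · exact forall_congr' fun hi => key i' j (by omega)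

theorem InsState.curEnd_move_iff (h : InsState T a r L y S) (hb : IsShape b) {L' : Line} (i : ℕ) :
    curEnd b L' (r + 1) (cur a L y S) i = b i + 1 ↔ L'.Contains (i, b i) ∧
      (i < b i → b i ≤ curEnd a L y S i) ∧ ∀ i', i = i' + 1 → b i < curEnd a L y S i' := by
  rw [curEnd_eq_succ_iff, h.valid_cur_iff (hb.le i)]

theorem InsState.slideStep_stay {N : ℕ} (h : InsState T a r L y S) (hT : IsLocal T)
    (ha : HasEnds T r a) (hb : HasEnds T (r + 1) b) (hN : b 0 < N)
    (hL : ∀ e, L.Contains e → T e ≠ some (r + 1)) :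
    SlideStep (N + 1) (lineLabel N a (curEnd a L y S) L) (lineLabel N b (curEnd b L y S) L) := by
  have h' := h.stay hT ha hb hL
  have hstrip := ha.rookStrip hT hb
  have hK := h.curEnd_stay hT ha hb hL
  have hno : ∀ i, L.Contains (i, a i) → b i = a i := by
    intro i hi
    by_contra hc
    have := hstrip.le i
    have := ha.shape.le i
    exact hL _ hi ((ha.eq_succ_iff hb i (a i)).2 (by omega))
  rcases L with p | s
  · have h1 := hno p rfl
    refine slideStep_row_stay ha.shape hb.shape hstrip hN h.rowState h'.rowState h1 ?_
    have := hK p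
    have := h.rowState.le
    omega
  · exact slideStep_col_stay ha.shape hb.shape hstrip hN h.colState h'.colState
      (fun i hi => (hno i hi).trans hi) hK

theorem InsState.slideStep_move {N : ℕ} (h : InsState T a r L y S) (hT : IsLocal T)
    (ha : HasEnds T r a) (hb : HasEnds T (r + 1) b) (hN : b 0 < N) {f : Box} (hf : L.Contains f)
    (hTf : T f = some (r + 1)) :
    SlideStep (N + 1) (lineLabel N a (curEnd a L y S) L)
      (lineLabel N b (curEnd b (L.next f) (r + 1) (cur a L y S)) (L.next f)) := by
  have h' := h.move hT ha hb hf hTf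
  have hstrip := ha.rookStrip hT hb
  have hK := fun L' => h.curEnd_move_iff hb.shape (L' := L')
  obtain ⟨f1, f2⟩ := f
  have h1 := (ha.eq_succ_iff hb f1 f2).1 hTf
  have h2 := hstrip.le_succ f1
  rcases L with p | s
  · obtain rfl : f1 = p := hf
    simp only [Line.next] at h' ⊢
    split_ifs at h' ⊢ with hd
    · subst hd
      refine slideStep_row_col ha.shape hb.shape hstrip hN h.rowState h'.colState (by omega)
        (by omega) fun i hbi hi => ?_
      have := hK (.col (f1 + 1)) i
      rw [hbi] at this
      rw [this]
      simp only [Line.Contains, true_and]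
      exact and_congr_left fun _ => ⟨fun h3 => h3 (by omega), fun h3 _ => h3⟩
    · refine slideStep_row_row ha.shape hb.shape hstrip hN h.rowState h'.rowState (by omega)
        (by omega) ?_
      rw [hK (.row (f1 + 1)) (f1 + 1)]
      have h3 := h.rowState.eq (f1 + 1) (by omega)
      have h4 := ha.shape.le (f1 + 1)
      have h5 := hb.shape.le (f1 + 1)
      simp only [Line.Contains, true_and, Nat.add_right_cancel_iff, forall_eq', h3]
      refine and_congr_left fun _ => ?_
      omega
  · obtain rfl : f2 = s := hf
    refine slideStep_col_col (f := f1) ha.shape hb.shape hstrip hN h.colState h'.colState (by omega)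
      (by omega) fun i hbi hi => ?_
    have := hK (.col (f2 + 1)) i
    rw [hbi] at this
    simp only [Line.next]
    rw [this]
    simp only [Line.Contains, true_and]
    exact and_congr_left fun _ => ⟨fun h3 => h3 (by omega), fun h3 _ => h3⟩

end

/-! ### Zeros and outer boundary of the explicit diagram -/

theorem IsShape.le_skewEnd {a : ℕ → ℕ} (ha : IsShape a) {M : ℕ} (hM : a 0 ≤ M) (i : ℕ) :
    a i ≤ skewEnd M a i := by
  rcases i with _ | i
  · exact hM
  · have := ha.succ i
    have := ha.le i
    simp only [skewEnd]
    omega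

section Labels

variable {T S : Filling ℕ} {a : ℕ → ℕ} {r y N : ℕ} {L : Line}

theorem preLabel_eq_zero_iff (i j : ℕ) :
    preLabel N a i j = 0 ↔ j < a i := by
  have := (preRow N a i).val_cases N j
  have := preRow_spec N a i
  unfold preLabel
  omega

theorem IsShape.preLabel_le_iff (ha : IsShape a) (hN : a 0 < N) (i j : ℕ) :
    preLabel N a i j ≤ N ↔ j < skewEnd N a i := by
  have := (preRow N a i).val_cases N j
  have := preRow_spec N a i
  have := ha.le_skewEnd hN.le i
  have := ha.skewEnd_le hN N i
  have := ha.le i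
  unfold preLabel
  omega

/-- A label from column K on could vanish only as `o` = p = 0 in the first row with `K 0` = 0, which
`zero` excludes. -/
theorem RowState.rowLabel_eq_zero_iff {K : ℕ → ℕ} {p : ℕ} (h : RowState a K p) (i j : ℕ) :
    rowLabel N a K p i j = 0 ↔ j < K i := by
  have := (rowRow N a K p i).val_cases N j
  have := rowRow_spec N a K p i
  have h0 := h.zero
  unfold rowLabel
  by_cases hi : i = 0
  · subst hi
    omega
  · omega

theorem RowState.rowLabel_le_iff {K : ℕ → ℕ} {p : ℕ} (h : RowState a K p) (ha : IsShape a)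
    (hN : a 0 < N) (i j : ℕ) : rowLabel N a K p i j ≤ N ↔ j < skewEnd (N + 1) a i := by
  have := (rowRow N a K p i).val_cases N j
  have := rowRow_spec N a K p i
  have := ha.skewEnd_le hN (N + 1) i
  have := ha.le i
  have h1 : a i ≤ K i ∧ K i ≤ skewEnd (N + 1) a i := by
    by_cases hi : i = p
    · subst hi
      exact ⟨h.le, (h.lt_skewEnd hN).le⟩
    · rw [h.eq i hi]
      exact ⟨le_rfl, ha.le_skewEnd (by omega) i⟩
  unfold rowLabel
  omega

theorem ColState.colLabel_eq_zero_iff {K : ℕ → ℕ} {s : ℕ} (h : ColState a K s) (i j : ℕ) :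
    colLabel N a K s i j = 0 ↔ j < K i := by
  have := (colRow N a K s i).val_cases N j
  have := colRow_spec N a K s i
  have h0 := h.zero
  have := h.eq i
  have := h.pos
  unfold colLabel
  by_cases hi : i = 0
  · subst hi
    omega
  · by_cases hj : j = 0
    · subst hj
      have := h.diag
      omega
    · omega

theorem ColState.colLabel_le_iff {K : ℕ → ℕ} {s : ℕ} (h : ColState a K s) (ha : IsShape a)
    (hN : a 0 < N) (i j : ℕ) : colLabel N a K s i j ≤ N ↔ j < skewEnd (N + 1) a i := by
  have := (colRow N a K s i).val_cases N j
  have := colRow_spec N a K s i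
  have := ha.skewEnd_le hN (N + 1) i
  have := ha.le i
  have := h.eq i
  have := h.lt_skewEnd hN i
  have := ha.le_skewEnd (M := N + 1) (by omega) i
  unfold colLabel
  omega

/-- The bridge between the two descriptions: the zeros of the growth diagram are the labels already
settled by the insertion. -/
theorem InsState.lineLabel_eq_zero_iff (h : InsState T a r L y S) (i j : ℕ) :
    lineLabel N a (curEnd a L y S) L i j = 0 ↔ j < i ∨ ∃ v ≤ r, cur a L y S (i, j) = some v := by
  have h1 : lineLabel N a (curEnd a L y S) L i j = 0 ↔ j < curEnd a L y S i := by
    rcases L with p | s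
    · exact h.rowState.rowLabel_eq_zero_iff i j
    · exact h.colState.colLabel_eq_zero_iff i j
  have h2 := le_curEnd a L y S i
  have h3 := h.ends.shape.le i
  rw [h1, h.cur_iff]
  omega

theorem InsState.lineLabel_le_iff (h : InsState T a r L y S) (hN : a 0 < N) (i j : ℕ) :
    lineLabel N a (curEnd a L y S) L i j ≤ N ↔ j < skewEnd (N + 1) a i := by
  rcases L with p | s
  · exact h.rowState.rowLabel_le_iff h.ends.shape hN i j
  · exact h.colState.colLabel_le_iff h.ends.shape hN i j

end Labels

/-! ### The whole growth diagram of an insertion -/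

theorem HasEnds.le_of_le {T : Filling ℕ} {r r' : ℕ} {a b : ℕ → ℕ} (ha : HasEnds T r a)
    (hb : HasEnds T r' b) (h : r ≤ r') (i : ℕ) : a i ≤ b i := by
  by_contra! hc
  have := hb.shape.le i
  obtain ⟨v, hv, hT⟩ := (ha.iff i (b i)).2 (by omega)
  have := (hb.iff i (b i)).1 ⟨v, by omega, hT⟩
  omega

/-- The growth diagram `U` of an insertion with result `P`, from the label `r` on. -/
structure IsGrowth (A : ℕ → ℕ → ℕ) (N q r : ℕ) (P : Filling ℕ) (U : ℕ → ℕ → ℕ → ℕ) : Prop where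
  isLocal : IsLocal P
  le (e : Box) (v : ℕ) (h : P e = some v) : v ≤ q
  top (j v : ℕ) (h : P (0, j) = some v) : j ≤ A q 0
  step (t : ℕ) (h : r ≤ t) (h' : t < q) : SlideStep (N + 1) (U t) (U (t + 1))
  eq_zero (t : ℕ) (h : r ≤ t) (h' : t ≤ q) (i j : ℕ) :
    U t i j = 0 ↔ j < i ∨ ∃ v ≤ t, P (i, j) = some v
  le_iff (t : ℕ) (h : r ≤ t) (h' : t ≤ q) (i j : ℕ) : U t i j ≤ N ↔ j < skewEnd (N + 1) (A t) i

/-- Growth diagrams are built backwards in time, one earlier state at a time, parallel to the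
recursion of the insertion. -/
theorem IsGrowth.extend {A : ℕ → ℕ → ℕ} {N q r : ℕ} {P : Filling ℕ} {U : ℕ → ℕ → ℕ → ℕ}
    (h : IsGrowth A N q (r + 1) P U) {V : ℕ → ℕ → ℕ} (hV : SlideStep (N + 1) V (U (r + 1)))
    (h0 : ∀ i j, V i j = 0 ↔ j < i ∨ ∃ v ≤ r, P (i, j) = some v)
    (hle : ∀ i j, V i j ≤ N ↔ j < skewEnd (N + 1) (A r) i) :
    IsGrowth A N q r P (Function.update U r V) where
  isLocal := h.isLocal
  le := h.le
  top := h.top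
  step t ht ht' := by
    rw [Function.update_of_ne (by omega : t + 1 ≠ r)]
    by_cases htr : t = r
    · subst htr
      rw [Function.update_self]
      exact hV
    · rw [Function.update_of_ne htr]
      exact h.step t (by omega) ht'
  eq_zero t ht ht' := by
    by_cases htr : t = r
    · subst htr
      rw [Function.update_self]
      exact h0
    · rw [Function.update_of_ne htr]
      exact h.eq_zero t (by omega) ht'
  le_iff t ht ht' := by
    by_cases htr : t = r
    · subst htr
      rw [Function.update_self]
      exact hle
    · rw [Function.update_of_ne htr]
      exact h.le_iff t (by omega) ht'

/-- Induction on the number d of label values still to come: the line either contains r + 1 or not.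
Agreement of P with `cur` on labels at most r is carried along, because it identifies the zeros of
the state at time r with labels of the final tableau. -/
theorem exists_growth {T : Filling ℕ} {A : ℕ → ℕ → ℕ} {N q : ℕ} (hT : IsLocal T)
    (hA : ∀ r, HasEnds T r (A r)) (hq : ∀ e v, T e = some v → v ≤ q) (hN : A q 0 < N) (d : ℕ) :
    ∀ r L y S, r + d = q → InsState T (A r) r L y S → ∃ P U, InsertsTo L S y P ∧
      (∀ e, ∀ v ≤ r, P e = some v ↔ cur (A r) L y S e = some v) ∧
      U r = lineLabel N (A r) (curEnd (A r) L y S) L ∧ IsGrowth A N q r P U := by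
  induction d with
  | zero =>
    intro r L y S hr h
    obtain rfl : r = q := hr
    have hS : ∀ e v, S e = some v → v ≤ r := by
      intro e v hv
      by_contra hc
      exact hc (hq e v ((h.high e v (by omega)).1 hv))
    have hle : ∀ e v, cur (A r) L y S e = some v → v ≤ r := by
      intro e v hv
      rcases h.cur_cases e with h1 | h1
      · exact hS e v (h1 ▸ hv)
      · rw [h1.1, Option.some.injEq] at hv
        have := h.le
        omega
    obtain ⟨e, he⟩ := h.exists_isFirst
    refine ⟨cur (A r) L y S, fun _ => lineLabel N (A r) (curEnd (A r) L y S) L,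
      h.insertsTo_last hS, fun _ _ _ => Iff.rfl, rfl, h.isLocal_cur he, hle, ?_,
      fun t h1 h2 => by omega, ?_, ?_⟩
    · intro j v hv
      have h1 := ((h.cur_iff 0 j).1 ⟨v, hle _ _ hv, hv⟩).2
      have h2 := curEnd_le (A r) L y S 0
      omega
    · intro t h1 h2 i j
      obtain rfl : t = r := by omega
      exact h.lineLabel_eq_zero_iff i j
    · intro t h1 h2 i j
      obtain rfl : t = r := by omega
      exact h.lineLabel_le_iff hN i j
  | succ d ih =>
    intro r L y S hr h
    have hN' : A (r + 1) 0 < N := ((hA (r + 1)).le_of_le (hA q) (by omega) 0).trans_lt hN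
    have hN'' : A r 0 < N := ((hA r).le_of_le (hA q) (by omega) 0).trans_lt hN
    by_cases hL : ∀ e, L.Contains e → T e ≠ some (r + 1)
    · have h' := h.stay hT (hA r) (hA (r + 1)) hL
      obtain ⟨P, U, hP, hlow, hU, hg⟩ := ih (r + 1) L y S (by omega) h'
      have hlow' : ∀ e, ∀ v ≤ r, P e = some v ↔ cur (A r) L y S e = some v := by
        intro e v hv
        rw [hlow e v (by omega), h.cur_eq_stay hT (hA r) (hA (r + 1)) hL]
      refine ⟨P, _, hP, hlow', Function.update_self .., hg.extend ?_ ?_ (h.lineLabel_le_iff hN'')⟩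
      · rw [hU]
        exact h.slideStep_stay hT (hA r) (hA (r + 1)) hN' hL
      · intro i j
        rw [h.lineLabel_eq_zero_iff]
        refine or_congr_right (exists_congr fun v => and_congr_right fun hv => ?_)
        exact (hlow' _ v hv).symm
    · push Not at hL
      obtain ⟨f, hf, hTf⟩ := hL
      have h' := h.move hT (hA r) (hA (r + 1)) hf hTf
      obtain ⟨P, U, hP, hlow, hU, hg⟩ := ih (r + 1) _ _ _ (by omega) h'
      have hlow' : ∀ e, ∀ v ≤ r, P e = some v ↔ cur (A r) L y S e = some v := by
        intro e v hv
        rw [hlow e v (by omega)]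
        -- Placing r + 1 later overwrites only larger labels or absent boxes, so labels at most r
        -- are final.
        rcases h'.cur_cases e with h1 | h1
        · rw [h1]
        · rw [h1.1]
          refine iff_of_false (by simp only [Option.some.injEq]; omega) fun h2 => ?_
          have := h1.2 v h2
          omega
      refine ⟨P, _, h.insertsTo_move hT (hA r) (hA (r + 1)) hf hTf hP, hlow',
        Function.update_self .., hg.extend ?_ ?_ (h.lineLabel_le_iff hN'')⟩
      · rw [hU]
        exact h.slideStep_move hT (hA r) (hA (r + 1)) hN' hf hTf
      · intro i j
        rw [h.lineLabel_eq_zero_iff]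
        refine or_congr_right (exists_congr fun v => and_congr_right fun hv => ?_)
        exact (hlow' _ v hv).symm

theorem IsLocal.insState {T : Filling ℕ} (hT : IsLocal T) {x : ℕ} {a : ℕ → ℕ} (ha : HasEnds T x a)
    (hx : 0 < x) : InsState T a x (.row 0) x T where
  isLocal := hT
  high _ _ _ := Iff.rfl
  ends := ha
  pos := hx
  le := le_rfl
  line _ _ _ _ h := h
  row p hp i hi := by
    simp only [Line.row.injEq] at hp
    omega
  col s hs := by cases hs

theorem IsLocal.slideStep_start {T : Filling ℕ} (hT : IsLocal T) {r N : ℕ} {a b : ℕ → ℕ}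
    (ha : HasEnds T r a) (hb : HasEnds T (r + 1) b) (hN : b 0 < N) :
    SlideStep (N + 1) (preLabel N a)
      (lineLabel N b (curEnd b (.row 0) (r + 1) T) (.row 0)) := by
  have hstrip := ha.rookStrip hT hb
  have h := hT.insState hb (Nat.succ_pos r)
  refine ShiftedHecke.slideStep_start ha.shape hb.shape hstrip hN h.rowState ?_
  rw [curEnd_eq_succ_iff]
  have h1 := hstrip.le 0
  have h2 := hstrip.le_succ 0
  constructor
  · rintro ⟨-, hv⟩
    by_contra hc
    obtain ⟨u, hu, h3⟩ := hv.1 (a 0) (by omega) (by omega)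
    have := (ha.iff 0 (a 0)).1 ⟨u, by omega, h3⟩
    omega
  · intro h3
    refine ⟨rfl, fun j hj _ => ?_, fun i hi => by omega⟩
    obtain ⟨u, hu, h4⟩ := (ha.iff 0 j).2 (by omega)
    exact ⟨u, by omega, h4⟩

theorem exists_insertsTo {T : Filling ℕ} {A : ℕ → ℕ → ℕ} {N q x : ℕ} (hT : IsLocal T)
    (hA : ∀ r, HasEnds T r (A r)) (hq : ∀ e v, T e = some v → v ≤ q) (hN : A q 0 < N)
    (hx : 0 < x) (hxq : x ≤ q) : ∃ (P : Filling ℕ) (U : ℕ → ℕ → ℕ → ℕ), InsertsTo (.row 0) T x P ∧ IsLocal P ∧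
      (∀ e v, P e = some v → v ≤ q) ∧ (∀ j v, P (0, j) = some v → j ≤ A q 0) ∧
      U 0 = preLabel N (A 0) ∧ (∀ t < q, SlideStep (N + 1) (U t) (U (t + 1))) ∧
      (∀ t ≤ q, ∀ i j, U t i j = 0 ↔ j < i ∨ ∃ v ≤ t, P (i, j) = some v) ∧
      ∀ t ≤ q, ∀ i j, U t i j ≤ N ↔ j < skewEnd (if x ≤ t then N + 1 else N) (A t) i := by
  have h := hT.insState (hA x) hx
  obtain ⟨P, U, hP, hlow, hU, hg⟩ := exists_growth hT hA hq hN (q - x) x _ _ _ (by omega) h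
  have hN' : ∀ t ≤ q, A t 0 < N := fun t ht => ((hA t).le_of_le (hA q) ht 0).trans_lt hN
  -- For t < x the labels have not met x, and the ribbon depends on the old tableau alone.
  refine ⟨P, fun t => if x ≤ t then U t else preLabel N (A t), hP, hg.isLocal, hg.le, hg.top,
    if_neg (by omega), ?_, ?_, ?_⟩
  · intro t ht
    by_cases h1 : x ≤ t
    · simp only [h1, show x ≤ t + 1 by omega, if_true]
      exact hg.step t h1 ht
    · by_cases h2 : x = t + 1
      · subst h2
        simp only [h1, le_refl, if_true, if_false, hU]
        exact hT.slideStep_start (hA t) (hA (t + 1)) (hN' _ ht)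
      · simp only [h1, show ¬ x ≤ t + 1 by omega, if_false]
        exact slideStep_pre (hA t).shape (hA (t + 1)).shape ((hA t).rookStrip hT (hA (t + 1)))
          (hN' _ ht)
  · intro t ht i j
    by_cases h1 : x ≤ t
    · simp only [h1, if_true]
      exact hg.eq_zero t h1 ht i j
    · simp only [h1, if_false]
      rw [preLabel_eq_zero_iff]
      have h2 : ∀ v ≤ t, P (i, j) = some v ↔ T (i, j) = some v := by
        intro v hv
        rw [hlow _ v (by omega)]
        rcases h.cur_cases (i, j) with h3 | h3
        · rw [h3]
        · rw [h3.1]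
          refine iff_of_false (by simp only [Option.some.injEq]; omega) fun h4 => ?_
          have := h3.2 v h4
          omega
      have h3 := (hA t).iff i j
      have h4 := (hA t).shape.le i
      rw [show (∃ v ≤ t, P (i, j) = some v) ↔ i ≤ j ∧ j < A t i from
        (exists_congr fun v => and_congr_right fun hv => h2 v hv).trans h3]
      omega
  · intro t ht i j
    by_cases h1 : x ≤ t
    · simp only [h1, if_true]
      exact hg.le_iff t h1 ht i j
    · simp only [h1, if_false]
      exact (hA t).shape.preLabel_le_iff (hN' t ht) i j

theorem IsLocal.hasEnds_zero {T : Filling ℕ} (hT : IsLocal T) {a : ℕ → ℕ} (ha : HasEnds T 0 a)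
    (i : ℕ) : a i = i := by
  have := ha.shape.le i
  by_contra hc
  obtain ⟨v, hv, h⟩ := (ha.iff i i).2 (by omega)
  have := hT.pos h
  omega

theorem preLabel_diag {N : ℕ} {a : ℕ → ℕ} (ha : ∀ i, a i = i) (i j : ℕ) :
    (j < i ∧ preLabel N a i j = 0) ∨ (i = 0 ∧ j < N ∧ preLabel N a i j = j + 1) ∨
      (i ≤ j ∧ (i = 0 → N ≤ j) ∧ preLabel N a i j = N + 1) := by
  have h := (preRow N a i).val_cases N j
  have := preRow_spec N a i
  have h1 := ha i
  have h2 : (i = 0 ∧ skewEnd N a i = N) ∨ (0 < i ∧ skewEnd N a i = i) := by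
    rcases i with _ | i
    · exact Or.inl ⟨rfl, rfl⟩
    · exact Or.inr ⟨Nat.succ_pos i, congrArg (· + 1) (ha i)⟩
  unfold preLabel
  omega

theorem isIncr_preLabel_diag {N : ℕ} {a : ℕ → ℕ} (ha : ∀ i, a i = i) :
    IsIncr (N + 1) (preLabel N a) where
  le i j := by
    have := preLabel_diag (N := N) ha i j
    omega
  row i j := by
    have := preLabel_diag (N := N) ha i j
    have := preLabel_diag (N := N) ha i (j + 1)
    omega
  col i j h := by
    have := preLabel_diag (N := N) ha i j
    have := preLabel_diag (N := N) ha (i + 1) j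
    omega
  below i j h := by
    have := preLabel_diag (N := N) ha i j
    omega

/-- Sliding a tableau, moved by `(1, 1)`, together with a box labelled `x` at the end of the first
row, into the boxes of the first row amounts to inserting `x`. -/
theorem foldl_kjdt_eq_insertion {T F : Filling ℕ} {C : ℕ → Set Box} {M N q x : ℕ} (hT : IsLocal T)
    (hq : ∀ e v, T e = some v → v ≤ q) (hM : ∀ j v, T (0, j) = some v → j < M) (hN : M < N)
    (hx : 0 < x) (hxq : x ≤ q) (h0 : F (0, N) = some x) (h0' : ∀ j, j ≠ N → F (0, j) = none)
    (hF : ∀ i, F (i + 1, 0) = none) (hF' : ∀ i j, F (i + 1, j + 1) = T (i, j))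
    (hC : ∀ m < N, C (m + 1) = {(0, m)}) :
    ∃ P, InsertsTo (.row 0) T x P ∧ IsLocal P ∧ (∀ e v, P e = some v → v ≤ q) ∧
      (∀ j v, P (0, j) = some v → j < M + 1) ∧
      (List.range' 1 N).reverse.foldl (fun S k => kjdt 1 q (C k) S) F = P := by
  choose A hA using fun r => hT.exists_hasEnds r
  have hAM : A q 0 ≤ M := by
    by_contra! hc
    obtain ⟨v, _, hv⟩ := ((hA q).iff 0 M).2 ⟨by omega, hc⟩
    exact lt_irrefl _ (hM _ _ hv)
  obtain ⟨P, U, hP, hloc, hle, htop, hU0, hstep, hzero, hleN⟩ :=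
    exists_insertsTo hT hA hq (hAM.trans_lt hN) hx hxq
  have hdiag := hT.hasEnds_zero (hA 0)
  have hI : ∀ t ≤ q, IsIncr (N + 1) (U t) := by
    intro t
    induction t with
    | zero => exact fun _ => hU0 ▸ isIncr_preLabel_diag hdiag
    | succ t ih => exact fun ht => (hstep t ht).isIncr (ih (by omega))
  refine ⟨P, hP, hloc, hle, fun j v h => by have := htop j v h; omega, ?_⟩
  -- The region with values at most N has row ends `A t` moved by (1, 1), and a first row that grows
  -- from N to N + 1 exactly at t = x. This reproduces the moved tableau and the box of x.
  have hFlevel : IsLevel U q N F := by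
    refine ⟨fun i j h => ?_, fun i j r => ?_⟩
    · rcases i with _ | i
      · by_cases hj : j = N
        · subst hj
          rw [h0, Option.some.injEq] at h
          omega
        · rw [h0' j hj] at h
          cases h
      · rcases j with _ | j
        · rw [hF] at h
          cases h
        · rw [hF'] at h
          exact (hT.pos h).false
    · by_cases hr : r < q
      · have h1 := hleN r hr.le i j
        have h2 := hleN (r + 1) hr i j
        rw [← not_le (a := U r i j), h1, h2]
        rcases i with _ | i
        · simp only [skewEnd, hr, true_and]
          by_cases hj : j = N
          · subst hj
            rw [h0, Option.some.injEq]
            split_ifs <;> omega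
          · rw [h0' j hj]
            refine iff_of_false (by simp) ?_
            split_ifs <;> omega
        · simp only [skewEnd, hr, true_and]
          have h3 := (hA r).shape.le i
          rcases j with _ | j
          · rw [hF]
            exact iff_of_false (by simp) (by omega)
          · rw [hF', (hA r).eq_succ_iff (hA (r + 1))]
            omega
      · refine iff_of_false (fun h => ?_) fun h => hr h.1
        rcases i with _ | i
        · by_cases hj : j = N
          · subst hj
            rw [h0, Option.some.injEq] at h
            omega
          · rw [h0' j hj] at h
            cases h
        · rcases j with _ | j
          · rw [hF] at h
            cases h
          · rw [hF'] at h
            have := hq _ _ h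
            omega
  -- A label of P is the time at which the value at its box first becomes 0.
  have hPlevel : IsLevel U q 0 P := by
    refine ⟨fun i j h => (hloc.pos h).false, fun i j r => ?_⟩
    by_cases hr : r < q
    · rw [Nat.le_zero, Nat.pos_iff_ne_zero, Ne, hzero r hr.le, hzero (r + 1) hr]
      constructor
      · intro h
        have := hloc.le h
        refine ⟨hr, ?_, Or.inr ⟨_, le_rfl, h⟩⟩
        rintro (h1 | ⟨v, hv, h1⟩)
        · omega
        · rw [h, Option.some.injEq] at h1
          omega
      · rintro ⟨-, h1, h2 | ⟨v, hv, h2⟩⟩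
        · exact absurd (Or.inl h2) h1
        · by_cases hvr : v = r + 1
          · rw [← hvr, h2]
          · exact absurd (Or.inr ⟨v, by omega, h2⟩) h1
    · refine iff_of_false (fun h => ?_) fun h => hr h.1
      have := hle _ _ h
      omega
  refine (hFlevel.foldl_kjdt (fun m hm b => ?_) hstep hI).unique hPlevel
  obtain ⟨i, j⟩ := b
  rw [hC m hm, hU0, Set.mem_singleton_iff, Prod.mk.injEq]
  have := preLabel_diag (N := N) hdiag i j
  simp only
  omega

/-! ### Shifted Hecke insertion has one result -/

theorem Line.IsEnd.unique {T : Filling ℕ} {L : Line} {b c : Box} (hb : L.IsEnd T b)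
    (hc : L.IsEnd T c) : b = c := by
  obtain ⟨b1, b2⟩ := b
  obtain ⟨c1, c2⟩ := c
  rcases L with p | s
  · obtain ⟨rfl, h1, h2, h3⟩ := hb
    obtain ⟨rfl, h4, h5, h6⟩ := hc
    rcases lt_trichotomy b2 c2 with h | rfl | h
    · exact absurd h2 (h6 _ h1 h)
    · rfl
    · exact absurd h5 (h3 _ h4 h)
  · obtain ⟨rfl, h2, h3⟩ := hb
    obtain ⟨h4, h5, h6⟩ := hc
    simp only at h4
    subst h4
    rcases lt_trichotomy b1 c1 with h | rfl | h
    · exact absurd h2 (h6 _ h)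
    · rfl
    · exact absurd h5 (h3 _ h)

theorem IsLocal.eq_of_contains {T : Filling ℕ} (hT : IsLocal T) {L : Line} {b c : Box} {v : ℕ}
    (hb : L.Contains b) (hc : L.Contains c) (h : T b = some v) (h' : T c = some v) : b = c := by
  obtain ⟨b1, b2⟩ := b
  obtain ⟨c1, c2⟩ := c
  rcases L with p | s
  · obtain rfl : b1 = p := hb
    obtain rfl : c1 = b1 := hc
    rcases lt_trichotomy b2 c2 with h1 | rfl | h1
    · obtain ⟨u, hu, h2⟩ := hT.left_lt h' (hT.le h) h1
      rw [h, Option.some.injEq] at h2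
      omega
    · rfl
    · obtain ⟨u, hu, h2⟩ := hT.left_lt h (hT.le h') h1
      rw [h', Option.some.injEq] at h2
      omega
  · obtain rfl : b2 = s := hb
    obtain rfl : c2 = b2 := hc
    rcases lt_trichotomy b1 c1 with h1 | rfl | h1
    · obtain ⟨u, hu, h2⟩ := hT.up_lt h' h1
      rw [h, Option.some.injEq] at h2
      omega
    · rfl
    · obtain ⟨u, hu, h2⟩ := hT.up_lt h h1
      rw [h', Option.some.injEq] at h2
      omega

theorem Line.IsBumped.unique {T : Filling ℕ} (hT : IsLocal T) {L : Line} {b c : Box} {x y z : ℕ}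
    (hb : L.IsBumped T x b y) (hc : L.IsBumped T x c z) : b = c ∧ y = z := by
  obtain rfl : y = z := le_antisymm (hb.2.2.2 c z hc.1 hc.2.1 hc.2.2.1)
    (hc.2.2.2 b y hb.1 hb.2.1 hb.2.2.1)
  exact ⟨hT.eq_of_contains hb.1 hc.1 hb.2.1 hc.2.1, rfl⟩

theorem Line.AllLE.not_isBumped {T : Filling ℕ} {L : Line} {b : Box} {x y : ℕ} (h : L.AllLE T x) :
    ¬ L.IsBumped T x b y := fun hb => by
  have := h b y hb.1 hb.2.1
  have := hb.2.2.1
  omega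

/-- The smallest larger label determines its box because labels on a line are distinct. This needs
an increasing tableau, a property that every rule preserves. -/
theorem InsertsTo.unique {L : Line} {T P Q : Filling ℕ} {x : ℕ} (h : InsertsTo L T x P)
    (hT : IsLocal T) (h' : InsertsTo L T x Q) : P = Q := by
  induction h with
  | adjoin hx hb h =>
    cases h' with
    | adjoin hx' hb' h' => rw [hb.unique hb']
    | stay hx' hb' h' => exact absurd (hb.unique hb' ▸ h) h'
    | replace hb' => exact absurd hb' hx.not_isBumped
    | bump hb' => exact absurd hb' hx.not_isBumped
  | stay hx hb h =>
    cases h' with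
    | adjoin hx' hb' h' => exact absurd h' (hb.unique hb' ▸ h)
    | stay hx' hb' h' => rfl
    | replace hb' => exact absurd hb' hx.not_isBumped
    | bump hb' => exact absurd hb' hx.not_isBumped
  | replace hb h rest ih =>
    cases h' with
    | adjoin hx' => exact absurd hb hx'.not_isBumped
    | stay hx' => exact absurd hb hx'.not_isBumped
    | replace hb' h' rest' =>
      obtain ⟨rfl, rfl⟩ := hb.unique hT hb'
      exact ih h.isLocal rest'
    | bump hb' h' rest' =>
      obtain ⟨rfl, rfl⟩ := hb.unique hT hb'
      exact absurd h h'
  | bump hb h rest ih =>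
    cases h' with
    | adjoin hx' => exact absurd hb hx'.not_isBumped
    | stay hx' => exact absurd hb hx'.not_isBumped
    | replace hb' h' rest' =>
      obtain ⟨rfl, rfl⟩ := hb.unique hT hb'
      exact absurd h' h
    | bump hb' h' rest' =>
      obtain ⟨rfl, rfl⟩ := hb.unique hT hb'
      exact ih hT rest'

theorem InsertsTo.isLocal {L : Line} {T P : Filling ℕ} {x : ℕ} (h : InsertsTo L T x P)
    (hT : IsLocal T) : IsLocal P := by
  induction h with
  | adjoin hx hb h => exact h.isLocal
  | stay hx hb h => exact hT
  | replace hb h rest ih => exact ih h.isLocal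
  | bump hb h rest ih => exact ih hT

theorem isLocal_empty : IsLocal fun _ => none where
  le h := by cases h
  pos h := by cases h
  left h := by cases h
  up h := by cases h
  bounded := ⟨0, fun _ _ _ h => by cases h⟩

theorem IsInsertionTableau.isLocal {w : List ℕ} {P : Filling ℕ} (h : IsInsertionTableau w P) :
    IsLocal P := by
  induction h with
  | nil => exact isLocal_empty
  | snoc hT hx ih => exact hx.isLocal ih

theorem IsInsertionTableau.unique {w : List ℕ} {P Q : Filling ℕ} (h : IsInsertionTableau w P)
    (h' : IsInsertionTableau w Q) : P = Q := by
  induction h generalizing Q with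
  | nil =>
    generalize hw : ([] : List ℕ) = w at h'
    cases h' with
    | nil => rfl
    | snoc _ _ => simp at hw
  | @snoc w x T T' hT hx ih =>
    generalize hw : w ++ [x] = w' at h'
    cases h' with
    | nil => simp at hw
    | snoc hT' hx' =>
      obtain ⟨rfl, h1⟩ := List.append_inj' hw rfl
      simp only [List.cons.injEq, and_true] at h1
      subst h1
      obtain rfl := ih hT'
      exact hx.unique hT.isLocal hx'

/-! ### Moving a filling by one row and one column -/

/-- The filling `F`, moved one row down and one column to the right, with an additional box labelled
`x` in the first row and column `N`. -/
def embed {α : Type} (N : ℕ) (x : α) (F : Filling α) : Filling α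
  | (0, j) => if j = N then some x else none
  | (_ + 1, 0) => none
  | (i + 1, j + 1) => F (i, j)

/-- The set `C`, moved one row down and one column to the right. -/
def shiftBoxes (C : Set Box) : Set Box :=
  {b | ∃ i j, b = (i + 1, j + 1) ∧ (i, j) ∈ C}

theorem switch_of_none {α : Type} (c d : α) {T : Filling α} {b : Box} (h : T b = none) :
    switch c d T b = none := by
  unfold switch
  simp [h]

theorem switch_of_isolated {α : Type} (c d : α) {T : Filling α} {b : Box}
    (h : ∀ e, Adjacent b e → T e = none) : switch c d T b = T b := by
  have key : ∀ x, ¬ ∃ e, Adjacent b e ∧ T e = some x := by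
    rintro x ⟨e, h1, h2⟩
    rw [h e h1] at h2
    cases h2
  unfold switch
  simp only [key, and_false, if_false]

theorem exists_adjacent_embed {α : Type} (N : ℕ) (x y : α) (F : Filling α) {i j : ℕ}
    (h : i ≠ 0 ∨ j + 1 ≠ N) : (∃ b, Adjacent (i + 1, j + 1) b ∧ embed N x F b = some y) ↔
      ∃ b, Adjacent (i, j) b ∧ F b = some y := by
  simp only [adjacent_iff]
  constructor
  · rintro ⟨b, rfl | rfl | ⟨j', h1, rfl⟩ | ⟨i', h1, rfl⟩, hb⟩
    · exact ⟨_, Or.inl rfl, hb⟩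
    · exact ⟨_, Or.inr (Or.inl rfl), hb⟩
    · obtain rfl : j = j' := by omega
      rcases j with _ | j
      · cases hb
      · exact ⟨_, Or.inr (Or.inr (Or.inl ⟨_, rfl, rfl⟩)), hb⟩
    · obtain rfl : i = i' := by omega
      rcases i with _ | i
      · simp only [embed] at hb
        rw [if_neg (by omega)] at hb
        cases hb
      · exact ⟨_, Or.inr (Or.inr (Or.inr ⟨_, rfl, rfl⟩)), hb⟩
  · rintro ⟨b, rfl | rfl | ⟨j', rfl, rfl⟩ | ⟨i', rfl, rfl⟩, hb⟩
    · exact ⟨(i + 1, j + 1 + 1), Or.inl rfl, hb⟩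
    · exact ⟨(i + 1 + 1, j + 1), Or.inr (Or.inl rfl), hb⟩
    · exact ⟨(i + 1, j' + 1), Or.inr (Or.inr (Or.inl ⟨_, rfl, rfl⟩)), hb⟩
    · exact ⟨(i' + 1, j + 1), Or.inr (Or.inr (Or.inr ⟨_, rfl, rfl⟩)), hb⟩

/-- The additional box could only interact with the box just below it, which is absent by `hF`; the
rest of the first row is absent as well. -/
theorem switch_embed {α : Type} (c d x : α) {M : ℕ} {F : Filling α} (hF : F (0, M) = none) :
    switch c d (embed (M + 1) x F) = embed (M + 1) x (switch c d F) := by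
  funext b
  obtain ⟨i, j⟩ := b
  rcases i with _ | i
  · by_cases hj : j = M + 1
    · subst hj
      rw [switch_of_isolated]
      · rfl
      · intro e he
        rw [adjacent_iff] at he
        rcases he with rfl | rfl | ⟨j', h1, rfl⟩ | ⟨i', h1, -⟩
        · simp [embed]
        · exact hF
        · obtain rfl : M = j' := by omega
          simp [embed]
        · omega
    · rw [switch_of_none] <;> simp [embed, hj]
  · rcases j with _ | j
    · rw [switch_of_none] <;> rfl
    · by_cases h : i = 0 ∧ j = M
      · obtain ⟨rfl, rfl⟩ := h
        rw [switch_of_none c d (show embed (j + 1) x F (0 + 1, j + 1) = none from hF)]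
        exact (switch_of_none c d hF).symm
      · have key := fun y => exists_adjacent_embed (M + 1) x y F (i := i) (j := j) (by omega)
        show switch c d (embed (M + 1) x F) (i + 1, j + 1) = switch c d F (i, j)
        have he : embed (M + 1) x F (i + 1, j + 1) = F (i, j) := rfl
        unfold switch
        classical
        exact if_congr (and_congr (by rw [he]) (key d)) rfl
          (if_congr (and_congr (by rw [he]) (key c)) rfl he)

theorem foldl_switch_embed {M : ℕ} (x : Label) (ks : List ℕ) :
    ∀ F : Filling Label, F (0, M) = none →
    ks.foldl (fun S r => switch (.num r) .circ S) (embed (M + 1) x F) =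
      embed (M + 1) x (ks.foldl (fun S r => switch (.num r) .circ S) F) ∧
    ks.foldl (fun S r => switch (.num r) .circ S) F (0, M) = none := by
  induction ks with
  | nil => exact fun F hF => ⟨rfl, hF⟩
  | cons k ks ih =>
    intro F hF
    rw [List.foldl_cons, List.foldl_cons, switch_embed _ _ _ hF]
    exact ih _ (switch_of_none _ _ hF)

theorem addCirc_embed (C : Set Box) (N x : ℕ) (F : Filling ℕ) :
    addCirc (shiftBoxes C) (embed N x F) = embed N (.num x) (addCirc C F) := by
  classical
  funext b
  obtain ⟨i, j⟩ := b
  unfold addCirc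
  rcases i with _ | i
  · rw [if_neg (by rintro ⟨i, j, h, -⟩; simp at h)]
    by_cases hj : j = N <;> simp [embed, hj]
  · rcases j with _ | j
    · rw [if_neg (by rintro ⟨i, j, h, -⟩; simp at h)]
      rfl
    · have : (i + 1, j + 1) ∈ shiftBoxes C ↔ (i, j) ∈ C := by
        simp only [shiftBoxes, Set.mem_ofPred_eq, Prod.mk.injEq, Nat.add_right_cancel_iff]
        constructor
        · rintro ⟨i, j, ⟨rfl, rfl⟩, h⟩
          exact h
        · exact fun h => ⟨i, j, ⟨rfl, rfl⟩, h⟩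
      simp only [this, embed]

theorem eraseCirc_embed (N x : ℕ) (F : Filling Label) :
    eraseCirc (embed N (.num x) F) = embed N x (eraseCirc F) := by
  funext b
  obtain ⟨i, j⟩ := b
  rcases i with _ | i
  · by_cases hj : j = N <;> simp [eraseCirc, embed, hj]
  · rcases j with _ | j
    · rfl
    · rfl

/-- Switches never add boxes, so the box below x remains absent; the second conclusion allows the
slides to be iterated. -/
theorem kjdt_embed {C : Set Box} {F : Filling ℕ} {M : ℕ} (lo hi x : ℕ) (hF : F (0, M) = none)
    (hC : (0, M) ∉ C) : kjdt lo hi (shiftBoxes C) (embed (M + 1) x F) =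
      embed (M + 1) x (kjdt lo hi C F) ∧ kjdt lo hi C F (0, M) = none := by
  have h0 : addCirc C F (0, M) = none := by
    unfold addCirc
    rw [if_neg hC, hF]
    rfl
  obtain ⟨h1, h2⟩ := foldl_switch_embed (.num x) (List.range' lo (hi + 1 - lo)) _ h0
  unfold kjdt
  refine ⟨?_, ?_⟩
  · rw [addCirc_embed, h1, eraseCirc_embed]
  · unfold eraseCirc
    rw [h2]

theorem foldl_kjdt_embed {C C' : ℕ → Set Box} {M : ℕ} (lo hi x d : ℕ) (ks : List ℕ) :
    ∀ F : Filling ℕ, F (0, M) = none → (∀ k ∈ ks, (0, M) ∉ C k) →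
    (∀ k ∈ ks, C' (d + k) = shiftBoxes (C k)) →
    (ks.map (d + ·)).foldl (fun S k => kjdt lo hi (C' k) S) (embed (M + 1) x F) =
      embed (M + 1) x (ks.foldl (fun S k => kjdt lo hi (C k) S) F) := by
  induction ks with
  | nil => exact fun F _ _ _ => rfl
  | cons k ks ih =>
    intro F hF hC hC'
    obtain ⟨h1, h2⟩ := kjdt_embed lo hi x hF (hC k (by simp))
    rw [List.map_cons, List.foldl_cons, List.foldl_cons, hC' k (by simp), h1]
    exact ih _ h2 (fun k hk => hC k (by simp [hk])) fun k hk => hC' k (by simp [hk])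

/-! ### The antidiagonal tableau -/

theorem antidiagonalInner_succ {n : ℕ} (hn : 0 < n) :
    antidiagonalInner (n + 1) = 2 * n :: antidiagonalInner n := by
  obtain ⟨n, rfl⟩ : ∃ n', n = n' + 1 := ⟨n - 1, by omega⟩
  unfold antidiagonalInner
  simp only [Nat.add_sub_cancel, List.range_succ_eq_map (n := n), List.map_cons, List.map_map]
  congr 1
  refine List.map_congr_left fun i _ => ?_
  simp only [Function.comp]
  omega

theorem antidiagonalFilling_append (w : List ℕ) (x : ℕ) :
    antidiagonalFilling (w ++ [x]) = embed (2 * w.length) x (antidiagonalFilling w) := by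
  funext b
  obtain ⟨i, j⟩ := b
  unfold antidiagonalFilling
  simp only [List.length_append, List.length_singleton, List.reverse_append, List.reverse_singleton,
    List.singleton_append]
  rcases i with _ | i
  · simp only [embed, List.getElem?_cons_zero]
    exact if_congr (by omega) rfl rfl
  · rw [List.getElem?_cons_succ]
    rcases j with _ | j
    · simp only [embed, ite_eq_right_iff]
      intro h
      rw [List.getElem?_eq_none]
      rw [List.length_reverse]
      omega
    · simp only [embed]
      exact if_congr (by omega) rfl rfl

theorem superstandard_cons_zero (m : ℕ) (l : List ℕ) (k : ℕ) (hk : k < m) :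
    {b | superstandard (m :: l) b = some (k + 1)} = {(0, k)} := by
  ext ⟨i, j⟩
  simp only [superstandard, Set.mem_ofPred_eq, Set.mem_singleton_iff, Prod.mk.injEq]
  rcases i with _ | i
  · simp only [List.getD_cons_zero, List.take_zero, List.sum_nil, true_and]
    split_ifs with h
    · simp only [Option.some.injEq]
      omega
    · simp only [false_iff]
      omega
  · refine iff_of_false ?_ (by simp)
    simp only [List.take_succ_cons, List.sum_cons]
    split_ifs with h
    · simp only [Option.some.injEq]
      omega
    · simp

theorem superstandard_cons_add (m : ℕ) (l : List ℕ) (k : ℕ) (hk : 0 < k) :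
    {b | superstandard (m :: l) b = some (m + k)} = shiftBoxes {b | superstandard l b = some k} := by
  ext ⟨i, j⟩
  simp only [superstandard, shiftBoxes, Set.mem_ofPred_eq, Prod.mk.injEq]
  rcases i with _ | i
  · simp only [List.getD_cons_zero, List.take_zero, List.sum_nil]
    refine iff_of_false ?_ ?_
    · split_ifs with h
      · simp only [Option.some.injEq]
        omega
      · simp
    · rintro ⟨i, j, ⟨h, -⟩, -⟩
      omega
  · simp only [List.getD_cons_succ, List.take_succ_cons, List.sum_cons]
    constructor
    · intro h
      split_ifs at h with h1
      obtain ⟨j, rfl⟩ : ∃ j', j = j' + 1 := ⟨j - 1, by omega⟩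
      refine ⟨i, j, ⟨rfl, rfl⟩, ?_⟩
      rw [if_pos (by omega)]
      simp only [Option.some.injEq] at h ⊢
      omega
    · rintro ⟨i', j', ⟨h1, rfl⟩, h⟩
      obtain rfl : i = i' := by omega
      split_ifs at h with h2
      rw [if_pos (by omega)]
      simp only [Option.some.injEq] at h ⊢
      omega

/-- Splits the slides into those for the lower rows, numbered above m and performed first, and the m
slides for the first row. -/
theorem foldl_range'_add {β : Type} (f : β → ℕ → β) (m n : ℕ) (z : β) :
    (List.range' 1 (m + n)).reverse.foldl f z =
      (List.range' 1 m).reverse.foldl f (((List.range' 1 n).reverse.map (m + ·)).foldl f z) := by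
  rw [← List.range'_append_1, List.reverse_append, List.foldl_append, List.map_reverse,
    List.map_add_range', add_comm 1 m]

theorem insertsTo_empty {x : ℕ} (hx : 0 < x) :
    InsertsTo (.row 0) (fun _ => none) x (Filling.set (fun _ => none) (0, 0) x) := by
  refine .adjoin (fun _ _ _ h => by cases h) ⟨rfl, le_rfl, rfl, fun j _ hj => by simp at hj⟩ ?_
  rw [isIncreasingTableau_iff, isLocal_empty.set_iff le_rfl hx fun v h => by cases h]
  exact ⟨fun j hj => by omega, fun i hi => by omega⟩

/-- The bound q is arbitrary, since all prefixes must use the largest entry of the whole word. The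
bound on the first row guarantees that the moved tableau ends before the box of x. -/
theorem exists_isInsertionTableau (q : ℕ) (w : List ℕ) (hw : ∀ x ∈ w, 0 < x ∧ x ≤ q) :
    ∃ P, IsInsertionTableau w P ∧ (∀ e v, P e = some v → v ≤ q) ∧
      (∀ j v, P (0, j) = some v → j < w.length) ∧
      (List.range' 1 (antidiagonalInner w.length).sum).reverse.foldl
        (fun S k => kjdt 1 q {b | superstandard (antidiagonalInner w.length) b = some k} S)
        (antidiagonalFilling w) = P := by
  induction w using List.reverseRecOn with
  | nil =>
    refine ⟨_, .nil, fun _ _ h => (by cases h), fun _ _ h => (by cases h), ?_⟩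
    funext b
    simp [antidiagonalInner, antidiagonalFilling]
  | append_singleton w x ih =>
    obtain ⟨P, hP, hle, htop, hfold⟩ := ih fun y hy => hw y (by simp [hy])
    obtain ⟨hx, hxq⟩ := hw x (by simp)
    -- For a single letter the inner shape is empty, without a row of length 2n = 0, and there is
    -- nothing to slide.
    rcases Nat.eq_zero_or_pos w.length with h0 | h0
    · obtain rfl := List.eq_nil_of_length_eq_zero h0
      have hset : ∀ e v, Filling.set (fun _ => none) (0, 0) x e = some v → e = (0, 0) ∧ v = x := by
        intro e v h
        rw [Filling.set_apply] at h
        split_ifs at h with h1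
        exact ⟨h1, by simpa using h.symm⟩
      refine ⟨_, .snoc .nil (insertsTo_empty hx), ?_, ?_, ?_⟩
      · intro e v h
        rw [(hset e v h).2]
        exact hxq
      · intro j v h
        have := (hset _ v h).1
        simp only [Prod.mk.injEq, true_and] at this
        simp [this]
      · funext ⟨i, j⟩
        simp only [List.nil_append, List.length_singleton, antidiagonalInner, Nat.sub_self,
          List.range_zero, List.map_nil, List.sum_nil, List.range'_zero, List.reverse_nil,
          List.foldl_nil, antidiagonalFilling, List.reverse_singleton]
        rw [Filling.set_apply]
        by_cases h : (i, j) = (0, 0)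
        · simp only [Prod.mk.injEq] at h
          simp [h.1, h.2]
        · rw [if_neg h, if_neg]
          simp only [Prod.mk.injEq] at h
          omega
    · set n := w.length with hn
      have hlen : (w ++ [x]).length = n + 1 := by simp [hn]
      rw [hlen, antidiagonalInner_succ h0, List.sum_cons, foldl_range'_add,
        antidiagonalFilling_append, ← hn]
      obtain ⟨M, hM⟩ : ∃ M, 2 * n = M + 1 := ⟨2 * n - 1, by omega⟩
      have h1 := foldl_kjdt_embed
        (C := fun k => {b | superstandard (antidiagonalInner n) b = some k})
        (C' := fun k => {b | superstandard (2 * n :: antidiagonalInner n) b = some k})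
        (M := M) 1 q x (2 * n) (List.range' 1 (antidiagonalInner n).sum).reverse
        (antidiagonalFilling w)
        (by
          unfold antidiagonalFilling
          rw [if_neg]
          simp only
          omega)
        (by
          intro k _
          simp only [Set.mem_ofPred_eq, superstandard, antidiagonalInner_getD]
          rw [if_neg (by omega)]
          simp)
        (by
          intro k hk
          have : 0 < k := by
            simp only [List.mem_reverse, List.mem_range'_1] at hk
            omega
          exact superstandard_cons_add _ _ k this)
      rw [hM] at h1 ⊢
      rw [h1, hfold]
      obtain ⟨Q, hQ, hQloc, hQle, hQtop, hQfold⟩ := foldl_kjdt_eq_insertion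
        (F := embed (M + 1) x P)
        (C := fun k => {b | superstandard ((M + 1) :: antidiagonalInner n) b = some k})
        hP.isLocal hle htop (show n < M + 1 by omega) hx hxq (by simp [embed])
        (fun j hj => by simp [embed, hj]) (fun _ => rfl) (fun _ _ => rfl)
        (fun m hm => superstandard_cons_zero _ _ m hm)
      exact ⟨Q, .snoc hP hQ, hQle, hQtop, hQfold⟩

theorem le_maxEntry (w : List ℕ) (hw : ∀ x ∈ w, 0 < x) {x : ℕ} (hx : x ∈ w) :
    x ≤ (antidiagonalTableau w hw).maxEntry := by
  refine le_csSup ⟨w.sum, ?_⟩ ?_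
  · rintro y ⟨b, hb⟩
    simp only [antidiagonalTableau, antidiagonalFilling] at hb
    split_ifs at hb
    exact List.single_le_sum (by simp) _ (List.mem_reverse.1 (List.mem_of_getElem? hb))
  · obtain ⟨i, hi, rfl⟩ := List.getElem_of_mem (List.mem_reverse.2 hx)
    refine ⟨(i, 2 * w.length - 2 - i), ?_⟩
    simp only [antidiagonalTableau, antidiagonalFilling]
    rw [List.length_reverse] at hi
    rw [if_pos (by omega), List.getElem?_eq_getElem]

end ShiftedHecke

theorem mainTheorem5 (w : List ℕ) (hw : ∀ x ∈ w, 0 < x) (P : ShiftedHecke.Filling ℕ) :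
    ShiftedHecke.IsInsertionTableau w P ↔
      P = (ShiftedHecke.antidiagonalTableau w hw).superstandardRectification := by
  obtain ⟨Q, hQ, -, -, hfold⟩ := ShiftedHecke.exists_isInsertionTableau
    (ShiftedHecke.antidiagonalTableau w hw).maxEntry w
    fun x hx => ⟨hw x hx, ShiftedHecke.le_maxEntry w hw hx⟩
  have h : (ShiftedHecke.antidiagonalTableau w hw).superstandardRectification = Q := hfold
  rw [h]
  -- The rectification is one insertion tableau, and uniqueness makes it the only one.
  exact ⟨fun hP => hP.unique hQ, fun hP => hP ▸ hQ⟩
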